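/- **Setting.** Let $\Delta>0$, let $n,m,q$ be positive integers, let $\mathcal C^d=C([-\Delta,0];\mathbb R^d)$ with the supremum norm $\|\cdot\|_\infty$ built on the Euclidean norm $|\cdot|$, and let $\mathcal C^d_\rho=\{\phi\in\mathcal C^d:\|\phi\|_\infty\le\rho\}$. For a function $x$ put $x_t(\theta)=x(t+\theta)$, $\theta\in[-\Delta,0]$. Let $f:\mathcal C^n\times\mathbb R^m\to\mathbb R^n$, $h:\mathcal C^n\to\mathbb R^q$, $\widehat f:\mathcal C^n\times\mathbb R^m\times\mathbb R^q\to\mathbb R^n$ and $k:\mathcal C^n\times\mathbb R^q\to\mathbb R^m$ be Lipschitz on bounded sets, with $f(0,0)=0$, $h(0)=0$, $\widehat f(0,0,0)=0$, $k(0,0)=0$. They describe the plant $\dot x(t)=f(x_t,u(t))$, $y(t)=h(x_t)$, and the observer-based controller $\dot{\hat x}(t)=\widehat f(\hat x_t,u(t),y(t))$, $u(t)=k(\hat x_t,y(t))$. For $\tilde\phi=(\tilde\phi_1,\tilde\phi_2)\in\mathcal C^{2n}$ and $\tilde u=(\tilde u_1,\tilde u_2)\in\mathbb R^{m}\times\mathbb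 R^n$ let $$F(\tilde\phi)=\begin{bmatrix}f(\tilde\phi_1,k(\tilde\phi_2,h(\tilde\phi_1)))\\ \widehat f(\tilde\phi_2,k(\tilde\phi_2,h(\tilde\phi_1)),h(\tilde\phi_1))\end{bmatrix},\qquad \widetilde F(\tilde\phi,\tilde u)=\begin{bmatrix}f(\tilde\phi_1,\tilde u_1)\\ \tilde u_2\end{bmatrix}.$$ For $V:\mathcal C^{2n}\to\mathbb R^+=[0,\infty)$ and $v\in\mathbb R^{2n}$ let $D^+_vV(\phi)=\limsup_{\tau\to0^+}\frac{V(\phi_{\tau,v})-V(\phi)}{\tau}\in[-\infty,+\infty]$, where $\phi_{\tau,v}(s)=\phi(s+\tau)$ for $s\in[-\Delta,-\tau)$ and $\phi_{\tau,v}(s)=\phi(0)+(s+\tau)v$ for $s\in[-\tau,0]$. A continuous $\gamma:\mathbb R^+\to\mathbb R^+$ is of class $\mathcal K$ if $\gamma(0)=0$ and $\gamma$ is strictly increasing, and of class $\mathcal K_\infty$ if it is moreover unbounded. **Assumption.** There exist $V:\mathcal C^{2n}\to\mathbb R^+$, a $C^1$ function $V_1:\mathbb R^{2n}\to\mathbb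 R^+$ with locally Lipschitz derivative, a locally Lipschitz $V_2:\mathcal C^{2n}\to\mathbb R^+$, functions $\beta_1,\beta_2,\gamma_1,\gamma_2$ of class $\mathcal K_\infty$, reals $\eta,\mu>0$, a $C^1$ function $p:\mathbb R^+\to\mathbb R^+$ of class $\mathcal K_\infty$ with locally Lipschitz derivative, $\nu\in\{0,1\}$, and $\alpha_3$ of class $\mathcal K$ such that, for all $\tilde\phi\in\mathcal C^{2n}$, * $V(\tilde\phi)=V_1(\tilde\phi(0))+V_2(\tilde\phi)$ and $\beta_1(|\tilde\phi(0)|)\le V_1(\tilde\phi(0))\le\beta_2(|\tilde\phi(0)|)$; * $\gamma_1(|\tilde\phi(0)|)\le V(\tilde\phi)\le\gamma_2(\|\tilde\phi\|_\infty)$ and $D^+_{F(\tilde\phi)}V(\tilde\phi)\le-\alpha_3(|\tilde\phi(0)|)$; * $\nu D^+_{F(\tilde\phi)}V(\tilde\phi)+\eta D^+_{F(\tilde\phi)}[p\circ V_1](\tilde\phi)+\eta\mu\,p(V_1(\tilde\phi(0)))\le0$, where $[p\circ V_1](\tilde\phi)=p(V_1(\tilde\phi(0)))$; and the map $(\tilde\phi,\tilde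 u)\mapsto D^+_{\widetilde F(\tilde\phi,\tilde u)}V_2(\tilde\phi)$ is finite and Lipschitz on bounded subsets of $\mathcal C^{2n}\times\mathbb R^{m+n}$. **Theorem 1.** Let the Assumption hold, and let $\tilde q>0$ and $a\in(0,1]$. For all reals $0<r<R$ there exist positive reals $\delta,T,E$ such that the following holds for every sequence $0=t_0<t_1<\cdots$ with $t_j\to\infty$ and $a\delta\le t_{j+1}-t_j\le\delta$ for all $j$, and for all absolutely continuous $x_0,\hat x_0:[-\Delta,0]\to\mathbb R^n$ with $\operatorname{ess\,sup}|\dot x_0|\le\tilde q/\sqrt2$, $\operatorname{ess\,sup}|\dot{\hat x}_0|\le\tilde q/\sqrt2$ and $(x_0,\hat x_0)\in\mathcal C^{2n}_R$. The sampled-data closed loop with initial states $x_0,\hat x_0$, $$\dot x(t)=f\big(x_t,k(\hat x_{t_j},h(x_{t_j}))\big)\quad\text{for a.e. }t\in[t_j,t_{j+1}),$$ $$\hat x(t_{j+1})=\hat x(t_j)+(t_{j+1}-t_j)\,\widehat f\big(\hat x_{t_j},k(\hat x_{t_j},h(x_{t_j})),h(x_{t_j})\big),\qquad j=0,1,\dots,$$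 where $x$ is continuous on its domain and locally absolutely continuous for $t\ge0$, and where, for $\theta\in[-\Delta,0]$, $\hat x_{t_j}(\theta)=\hat x_0(t_j+\theta)$ if $t_j+\theta\le0$ and $$\hat x_{t_j}(\theta)=\hat x(t_l)+\frac{t_j+\theta-t_l}{t_{l+1}-t_l}\big(\hat x(t_{l+1})-\hat x(t_l)\big),\quad t_l=\max\{t_i:t_i\le t_j+\theta\},\quad\text{if }t_j+\theta>0,$$ has a solution on the whole of $[0,\infty)$; this solution is unique, in the sense that every solution on an interval $[0,b)$, $0<b\le\infty$, is a restriction of it; and it satisfies $$\begin{bmatrix}x_t\\ \hat x_{t_j}\end{bmatrix}\in\mathcal C^{2n}_E\quad\forall t\ge0,\ \forall j,\qquad\begin{bmatrix}x_t\\ \hat x_{t_j}\end{bmatrix}\in\mathcal C^{2n}_r\quad\forall t\ge T,\ \forall j\text{ with }t_j\ge T.$$ -/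

import Mathlib

open Set Filter Topology MeasureTheory

noncomputable section

namespace EulerEmulation

/-- The real Euclidean space of dimension `d`. -/
abbrev Eu (d : ℕ) : Type := EuclideanSpace ℝ (Fin d)

/-- The Euclidean space `ℝ²ⁿ`; the first `n` coordinates are indexed by `Sum.inl`, the last `n`
coordinates by `Sum.inr`. -/
abbrev Eu2 (n : ℕ) : Type := EuclideanSpace ℝ (Fin n ⊕ Fin n)

/-- The column vector `(v, w)` of `ℝ²ⁿ`. -/
def stack {n : ℕ} (v w : Eu n) : Eu2 n := WithLp.toLp 2 (Sum.elim v w)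

/-- The first block of a vector of `ℝ²ⁿ`. -/
def topBlock {n : ℕ} (v : Eu2 n) : Eu n := WithLp.toLp 2 fun i => v (Sum.inl i)

/-- The second block of a vector of `ℝ²ⁿ`. -/
def botBlock {n : ℕ} (v : Eu2 n) : Eu n := WithLp.toLp 2 fun i => v (Sum.inr i)

/-- The space of continuous functions from `[-Δ, 0]` to `E`, with the supremum norm. -/
abbrev Hist (Δ : ℝ) (E : Type) [TopologicalSpace E] : Type := C(Icc (-Δ) (0 : ℝ), E)

instance factLe (Δ : ℝ) [hΔ : Fact (0 < Δ)] : Fact (-Δ ≤ (0 : ℝ)) :=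
  ⟨by linarith [hΔ.out]⟩

/-- The point `0` of `[-Δ, 0]`. -/
def zeroPt (Δ : ℝ) [hΔ : Fact (0 < Δ)] : Icc (-Δ) (0 : ℝ) :=
  ⟨0, by linarith [hΔ.out], le_rfl⟩

/-! ### Comparison functions and regularity classes -/

/-- Class `𝒦`: functions on `[0, ∞)` that are continuous, zero at zero and strictly increasing
(only the values on `[0, ∞)` matter). -/
def IsClassK (γ : ℝ → ℝ) : Prop :=
  ContinuousOn γ (Ici 0) ∧ γ 0 = 0 ∧ StrictMonoOn γ (Ici 0)

/-- Class `𝒦_∞`: unbounded functions of class `𝒦`. -/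
def IsClassKInfty (γ : ℝ → ℝ) : Prop :=
  IsClassK γ ∧ ¬ BddAbove (γ '' Ici 0)

/-- Continuously differentiable functions on `[0, ∞)` (one-sided derivative at `0`)
with locally Lipschitz derivative. -/
def IsC1LOnNonneg (p : ℝ → ℝ) : Prop :=
  ∃ p' : ℝ → ℝ, (∀ s ∈ Ici (0 : ℝ), HasDerivWithinAt p (p' s) (Ici 0) s) ∧
    LocallyLipschitzOn (Ici 0) p'

/-- Lipschitz on bounded sets. -/
def LipschitzOnBounded {X Y : Type} [PseudoMetricSpace X] [PseudoMetricSpace Y]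
    (g : X → Y) : Prop :=
  ∀ S : Set X, Bornology.IsBounded S → ∃ K : NNReal, LipschitzOnWith K g S

/-! ### The derivative in Driver's form -/

section Driver

variable {Δ : ℝ} [hΔ : Fact (0 < Δ)] {E : Type} [NormedAddCommGroup E] [NormedSpace ℝ E]

/-- For a velocity `v`, the function equal to `φ (s + h)` for `s ∈ [-Δ, -h)` and to
`φ 0 + (s + h) v` for `s ∈ [-h, 0]` (used for `0 ≤ h < Δ`; `IccExtendCM φ` extends `φ` to the
real line by constants and serves to write `φ (s + h)`). -/
def driverShift (φ : Hist Δ E) (h : ℝ) (v : E) : Hist Δ E where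
  toFun s := if (s : ℝ) < -h then ContinuousMap.IccExtendCM φ ((s : ℝ) + h)
    else φ (zeroPt Δ) + ((s : ℝ) + h) • v
  continuous_toFun := by
    have h0 : ContinuousMap.IccExtendCM φ (0 : ℝ) = φ (zeroPt Δ) :=
      ContinuousMap.IccExtendCM_of_mem (f := φ) (zeroPt Δ).2
    have e : (fun s : Icc (-Δ) (0 : ℝ) =>
        if (s : ℝ) < -h then ContinuousMap.IccExtendCM φ ((s : ℝ) + h)
        else φ (zeroPt Δ) + ((s : ℝ) + h) • v) =
        fun s : Icc (-Δ) (0 : ℝ) => if -h ≤ (s : ℝ) then φ (zeroPt Δ) + ((s : ℝ) + h) • v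
          else ContinuousMap.IccExtendCM φ ((s : ℝ) + h) := by
      funext s
      by_cases hs : (s : ℝ) < -h
      · simp [hs, not_le.mpr hs]
      · simp [hs, not_lt.mp hs]
    rw [e]
    refine Continuous.if_le (by fun_prop) (by fun_prop) (by fun_prop) (by fun_prop) ?_
    intro s hs
    have hz : (s : ℝ) + h = 0 := by rw [← hs]; ring
    rw [hz, h0, zero_smul, add_zero]

/-- `D⁺V (φ, u) = limsup_{h → 0⁺} (V φ_{h,u} - V φ) / h`, in the extended reals, with respect to a
system `ẋ(t) = G (x_t, u(t))`; here `v = G (φ, u)` is the velocity. -/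
def driverDeriv (V : Hist Δ E → ℝ) (φ : Hist Δ E) (v : E) : EReal :=
  limsup (fun h : ℝ => (((V (driverShift φ h v) - V φ) / h : ℝ) : EReal)) (𝓝[>] 0)

/-- `V` is smoothly separable, with the decomposition `V φ = V₁ (φ 0) + V₂ φ`
and the bounds `β₁ |φ 0| ≤ V₁ (φ 0) ≤ β₂ |φ 0|`. -/
structure SmoothlySeparable (V : Hist Δ E → ℝ) (V₁ : E → ℝ) (V₂ : Hist Δ E → ℝ)
    (β₁ β₂ : ℝ → ℝ) : Prop where
  V₁_nonneg : ∀ v, 0 ≤ V₁ v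
  V₁_contDiff : ContDiff ℝ 1 V₁
  V₁_lipschitz : LocallyLipschitz (fderiv ℝ V₁)
  V₂_nonneg : ∀ φ, 0 ≤ V₂ φ
  V₂_lipschitz : LocallyLipschitz V₂
  β₁_class : IsClassKInfty β₁
  β₂_class : IsClassKInfty β₂
  split : ∀ φ, V φ = V₁ (φ (zeroPt Δ)) + V₂ φ
  bounds : ∀ φ : Hist Δ E,
    β₁ ‖φ (zeroPt Δ)‖ ≤ V₁ (φ (zeroPt Δ)) ∧ V₁ (φ (zeroPt Δ)) ≤ β₂ ‖φ (zeroPt Δ)‖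

end Driver

/-! ### Pairs of histories, the closed-loop system and the extended open-loop system -/

section System

variable {Δ : ℝ} {n m q : ℕ}

/-- The function `θ ↦ (φ θ, ψ θ)`. -/
def pairHist (φ ψ : Hist Δ (Eu n)) : Hist Δ (Eu2 n) where
  toFun θ := stack (φ θ) (ψ θ)
  continuous_toFun := by
    refine (PiLp.continuous_toLp 2 _).comp (continuous_pi fun i => ?_)
    rcases i with i | i <;> simp only [Sum.elim_inl, Sum.elim_inr] <;> fun_prop

/-- First component of a function with values in `ℝ²ⁿ`. -/
def fstHist (φ : Hist Δ (Eu2 n)) : Hist Δ (Eu n) where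
  toFun θ := topBlock (φ θ)
  continuous_toFun := (PiLp.continuous_toLp 2 _).comp (continuous_pi fun i => by fun_prop)

/-- Second component of a function with values in `ℝ²ⁿ`. -/
def sndHist (φ : Hist Δ (Eu2 n)) : Hist Δ (Eu n) where
  toFun θ := botBlock (φ θ)
  continuous_toFun := (PiLp.continuous_toLp 2 _).comp (continuous_pi fun i => by fun_prop)

/-- The right-hand side `F` of the closed loop of plant and observer. -/
def closedLoop (f : Hist Δ (Eu n) × Eu m → Eu n) (hout : Hist Δ (Eu n) → Eu q)
    (fhat : Hist Δ (Eu n) × Eu m × Eu q → Eu n) (k : Hist Δ (Eu n) × Eu q → Eu m)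
    (φ : Hist Δ (Eu2 n)) : Eu2 n :=
  let y := hout (fstHist φ)
  let u := k (sndHist φ, y)
  stack (f (fstHist φ, u)) (fhat (sndHist φ, u, y))

/-- The right-hand side `(f (φ₁, u₁), u₂)` of the system with the inputs `u₁ ∈ ℝᵐ` (of the plant)
and `u₂ ∈ ℝⁿ` (velocity of the observer state). -/
def openLoop (f : Hist Δ (Eu n) × Eu m → Eu n) (φ : Hist Δ (Eu2 n)) (u : Eu m × Eu n) : Eu2 n :=
  stack (f (fstHist φ, u.1)) u.2

/-- The standing Lyapunov–Krasovskii assumption on the closed loop. -/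
def LyapunovAssumption [Fact (0 < Δ)]
    (f : Hist Δ (Eu n) × Eu m → Eu n) (hout : Hist Δ (Eu n) → Eu q)
    (fhat : Hist Δ (Eu n) × Eu m × Eu q → Eu n) (k : Hist Δ (Eu n) × Eu q → Eu m) : Prop :=
  ∃ (V : Hist Δ (Eu2 n) → ℝ) (V₁ : Eu2 n → ℝ) (V₂ : Hist Δ (Eu2 n) → ℝ)
    (β₁ β₂ γ₁ γ₂ p α₃ : ℝ → ℝ) (η μ ν : ℝ),
    SmoothlySeparable V V₁ V₂ β₁ β₂ ∧
    IsClassKInfty γ₁ ∧ IsClassKInfty γ₂ ∧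
    0 < η ∧ 0 < μ ∧
    IsC1LOnNonneg p ∧ IsClassKInfty p ∧
    (ν = 0 ∨ ν = 1) ∧
    IsClassK α₃ ∧
    (∀ φ, γ₁ ‖φ (zeroPt Δ)‖ ≤ V φ ∧ V φ ≤ γ₂ ‖φ‖) ∧
    (∀ φ, driverDeriv V φ (closedLoop f hout fhat k φ) ≤ ((-α₃ ‖φ (zeroPt Δ)‖ : ℝ) : EReal)) ∧
    (∀ φ, (ν : EReal) * driverDeriv V φ (closedLoop f hout fhat k φ)
        + (η : EReal) * driverDeriv (fun ψ => p (V₁ (ψ (zeroPt Δ)))) φ (closedLoop f hout fhat k φ)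
        + ((η * μ * p (V₁ (φ (zeroPt Δ))) : ℝ) : EReal) ≤ 0) ∧
    (∃ g : Hist Δ (Eu2 n) × (Eu m × Eu n) → ℝ,
      (∀ φ u, driverDeriv V₂ φ (openLoop f φ u) = (g (φ, u) : EReal)) ∧
      LipschitzOnBounded g)

end System

/-! ### Initial states, partitions and the sampled-data closed loop -/

/-- `φ ∈ W^{1,∞}` (absolutely continuous with essentially bounded derivative) and
`ess sup |dφ/dθ| ≤ L`. -/
def W1InftyBound {Δ : ℝ} [Fact (0 < Δ)] {n : ℕ} (φ : Hist Δ (Eu n)) (L : ℝ) : Prop :=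
  AbsolutelyContinuousOnInterval (ContinuousMap.IccExtendCM φ) (-Δ) 0 ∧
    ∀ᵐ θ ∂(volume.restrict (Icc (-Δ) (0 : ℝ))), ‖deriv (ContinuousMap.IccExtendCM φ) θ‖ ≤ L

/-- Partitions `0 = t₀ < t₁ < ⋯`, `t_j → ∞`, of `[0, ∞)` with
`a δ ≤ t_{j+1} - t_j ≤ δ` for all `j`. -/
structure IsPartition (a δ : ℝ) (t : ℕ → ℝ) : Prop where
  zero : t 0 = 0
  strictMono : StrictMono t
  tendsto : Tendsto t atTop atTop
  dwell : ∀ j, a * δ ≤ t (j + 1) - t j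
  diam : ∀ j, t (j + 1) - t j ≤ δ

open Classical in
/-- A function of the real variable, restricted to `[-Δ, 0]`, as an element of `Hist Δ E`
(it is only used for functions that are continuous on `[-Δ, 0]`). -/
def toHist (Δ : ℝ) {E : Type} [NormedAddCommGroup E] (g : ℝ → E) : Hist Δ E :=
  if hg : ContinuousOn g (Icc (-Δ) 0) then ⟨(Icc (-Δ) (0 : ℝ)).domRestrict g, hg.domRestrict⟩ else 0

/-- The history `x_s`, `x_s θ = x (s + θ)`. -/
def hist (Δ : ℝ) {E : Type} [NormedAddCommGroup E] (x : ℝ → E) (s : ℝ) : Hist Δ E :=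
  toHist Δ fun θ => x (s + θ)

/-- Piecewise linear interpolation of the observer samples `z l` (the observer state at `t l`)
at the time `s`; the initial observer history is used for `s ≤ 0`. -/
def interp {Δ : ℝ} [Fact (0 < Δ)] {n : ℕ} (t : ℕ → ℝ) (xhat₀ : Hist Δ (Eu n)) (z : ℕ → Eu n)
    (s : ℝ) : Eu n :=
  if s ≤ 0 then ContinuousMap.IccExtendCM xhat₀ s
  else
    let l := sSup {l : ℕ | t l ≤ s}
    z l + ((s - t l) / (t (l + 1) - t l)) • (z (l + 1) - z l)

/-- The history of the interpolated observer state at the sampling time `t j`. -/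
def obsHist {Δ : ℝ} [Fact (0 < Δ)] {n : ℕ} (t : ℕ → ℝ) (xhat₀ : Hist Δ (Eu n)) (z : ℕ → Eu n)
    (j : ℕ) : Hist Δ (Eu n) :=
  hist Δ (interp t xhat₀ z) (t j)

/-- `(x, z)` solves, on the time interval `[0, b)`, the sampled-data closed loop with sampling
times `t j` and initial states `x₀`, `xhat₀`. Here `x` is the plant state (only its values on
`[-Δ, b)` matter) and `z j` is the observer state at time `t j`. -/
structure IsSampledSolution {Δ : ℝ} [Fact (0 < Δ)] {n m q : ℕ}
    (f : Hist Δ (Eu n) × Eu m → Eu n) (hout : Hist Δ (Eu n) → Eu q)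
    (fhat : Hist Δ (Eu n) × Eu m × Eu q → Eu n) (k : Hist Δ (Eu n) × Eu q → Eu m)
    (t : ℕ → ℝ) (x₀ xhat₀ : Hist Δ (Eu n)) (b : EReal)
    (x : ℝ → Eu n) (z : ℕ → Eu n) : Prop where
  init : ∀ θ : Icc (-Δ) (0 : ℝ), x θ = x₀ θ
  obs_init : z 0 = xhat₀ (zeroPt Δ)
  cont : ContinuousOn x {s : ℝ | -Δ ≤ s ∧ (s : EReal) < b}
  abs_cont : ∀ c : ℝ, 0 ≤ c → (c : EReal) < b → AbsolutelyContinuousOnInterval x 0 c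
  ode : ∀ j, ∀ᵐ s : ℝ, s ∈ Ico (t j) (t (j + 1)) → (s : EReal) < b →
    HasDerivAt x
      (f (hist Δ x s, k (obsHist t xhat₀ z j, hout (hist Δ x (t j))))) s
  euler : ∀ j, (t j : EReal) < b →
    z (j + 1) = z j + (t (j + 1) - t j) •
      fhat (obsHist t xhat₀ z j,
        k (obsHist t xhat₀ z j, hout (hist Δ x (t j))),
        hout (hist Δ x (t j)))

end EulerEmulation

end

/-!
The plant and the interpolated observer together form one delay system
`ξ'(s) = A (ξ_s, ξ_{t_j})` on `[t_j, t_{j+1})`, where `A (φ, ψ)` is `F̃` at `φ` with the inputs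
computed from the sampled history `ψ`, so that `A (φ, φ) = F φ`. Along this system `V` changes at
the rate `G (φ, ψ) = DV₁ (φ 0) (A (φ, ψ)) + D⁺V₂ (φ)`, which is Lipschitz on bounded sets and at
most `-α₃ |φ 0|` for `ψ = φ`. Solutions are uniformly Lipschitz while they stay in a fixed ball, so
sampling with step `δ` perturbs the rate by `O(δ)` only.

The rate sees the current state `ξ(s)` and not the whole history. If `|ξ| > η` somewhere on a window
of length `Δ`, then `|ξ| ≥ η / 2` for a definite time around it and `V` drops by a fixed amount over
the window; otherwise `‖ξ_s‖ ≤ η`, hence `V ≤ γ₂ η`. Therefore `V`, and with it `|ξ|`, becomes small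
after finitely many windows.

Solutions exist because the radially truncated field is globally Lipschitz, so that the integral
equation is a contraction in an exponentially weighted norm; the decay of `V` keeps the solution
where the truncation is inactive.
-/

namespace EulerEmulation

open scoped NNReal

/-! ### Maps that are Lipschitz on bounded sets -/

namespace LipschitzOnBounded

variable {X Y Z : Type} [PseudoMetricSpace X] [PseudoMetricSpace Y] [PseudoMetricSpace Z]

theorem isBounded_image {g : X → Y} (hg : LipschitzOnBounded g) {S : Set X}
    (hS : Bornology.IsBounded S) : Bornology.IsBounded (g '' S) := by
  obtain ⟨K, hK⟩ := hg S hS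
  obtain ⟨C, hC⟩ := Metric.isBounded_iff.1 hS
  refine Metric.isBounded_iff.2 ⟨K * C, ?_⟩
  rintro _ ⟨x, hx, rfl⟩ _ ⟨y, hy, rfl⟩
  exact (hK.dist_le_mul x hx y hy).trans (by gcongr; exact hC hx hy)

theorem comp {g : Y → Z} {h : X → Y} (hg : LipschitzOnBounded g) (hh : LipschitzOnBounded h) :
    LipschitzOnBounded fun x => g (h x) := by
  intro S hS
  obtain ⟨K, hK⟩ := hh S hS
  obtain ⟨K', hK'⟩ := hg _ (hh.isBounded_image hS)
  exact ⟨K' * K, hK'.comp hK (mapsTo_image h S)⟩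

theorem prodMk {g : X → Y} {h : X → Z} (hg : LipschitzOnBounded g) (hh : LipschitzOnBounded h) :
    LipschitzOnBounded fun x => (g x, h x) := by
  intro S hS
  obtain ⟨K, hK⟩ := hg S hS
  obtain ⟨K', hK'⟩ := hh S hS
  exact ⟨max K K', hK.prodMk hK'⟩

theorem of_lipschitzWith {g : X → Y} {K : NNReal} (hg : LipschitzWith K g) :
    LipschitzOnBounded g := fun _ _ => ⟨K, hg.lipschitzOnWith⟩

theorem fst : LipschitzOnBounded fun x : X × Y => x.1 := of_lipschitzWith LipschitzWith.prod_fst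

theorem snd : LipschitzOnBounded fun x : X × Y => x.2 := of_lipschitzWith LipschitzWith.prod_snd

theorem of_locallyLipschitz [ProperSpace X] {g : X → Y} (hg : LocallyLipschitz g) :
    LipschitzOnBounded g := by
  intro S hS
  obtain ⟨K, hK⟩ := (hg.locallyLipschitzOn (s := closure S)).exists_lipschitzOnWith_of_compact
    hS.isCompact_closure
  exact ⟨K, hK.mono subset_closure⟩

theorem add {F : Type} [SeminormedAddCommGroup F] {g h : X → F} (hg : LipschitzOnBounded g)
    (hh : LipschitzOnBounded h) : LipschitzOnBounded fun x => g x + h x := by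
  intro S hS
  obtain ⟨K, hK⟩ := hg S hS
  obtain ⟨K', hK'⟩ := hh S hS
  exact ⟨K + K', hK.add hK'⟩

theorem clm_apply {F G : Type} [NormedAddCommGroup F] [NormedSpace ℝ F] [NormedAddCommGroup G]
    [NormedSpace ℝ G] {B : X → F →L[ℝ] G} {v : X → F} (hB : LipschitzOnBounded B)
    (hv : LipschitzOnBounded v) : LipschitzOnBounded fun x => B x (v x) := by
  intro S hS
  obtain ⟨K, hK⟩ := hB S hS
  obtain ⟨K', hK'⟩ := hv S hS
  obtain ⟨b, hb0, hb⟩ := (hB.isBounded_image hS).exists_pos_norm_le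
  obtain ⟨c, -, hc⟩ := (hv.isBounded_image hS).exists_pos_norm_le
  refine ⟨_, LipschitzOnWith.of_dist_le' (K := b * K' + K * c) fun x hx y hy => ?_⟩
  have hdist_B := hK.dist_le_mul x hx y hy
  have hdist_v := hK'.dist_le_mul x hx y hy
  have hsplit : B x (v x) - B y (v y) = B x (v x - v y) + (B x - B y) (v y) := by
    simp
  rw [dist_eq_norm] at hdist_B hdist_v ⊢
  rw [hsplit]
  calc _ ≤ ‖B x‖ * ‖v x - v y‖ + ‖B x - B y‖ * ‖v y‖ :=
        (norm_add_le _ _).trans (add_le_add ((B x).le_opNorm _) ((B x - B y).le_opNorm _))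
    _ ≤ b * (K' * dist x y) + K * dist x y * c := by
        gcongr
        · exact hb _ ⟨x, hx, rfl⟩
        · exact hc _ ⟨y, hy, rfl⟩
    _ = _ := by ring

theorem continuous {F : Type} [SeminormedAddCommGroup F] {g : F → Y} (hg : LipschitzOnBounded g) :
    Continuous g := by
  refine continuous_iff_continuousAt.2 fun x => ?_
  obtain ⟨K, hK⟩ := hg (Metric.ball x 1) Metric.isBounded_ball
  exact hK.continuousOn.continuousAt (Metric.ball_mem_nhds x one_pos)

end LipschitzOnBounded

/-! ### Radial truncation -/

section RadialTruncation

variable {F : Type} [NormedAddCommGroup F] [NormedSpace ℝ F]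

/-- The radial retraction onto the closed ball of radius `ρ`, used to make maps that are Lipschitz
on bounded sets globally Lipschitz and bounded. -/
noncomputable def radialClamp (ρ : ℝ) (x : F) : F := (ρ / max ρ ‖x‖) • x

theorem radialClamp_of_norm_le {ρ : ℝ} (hρ : 0 < ρ) {x : F} (hx : ‖x‖ ≤ ρ) :
    radialClamp ρ x = x := by
  rw [radialClamp, max_eq_left hx, div_self hρ.ne', one_smul]

theorem norm_radialClamp_le {ρ : ℝ} (hρ : 0 < ρ) (x : F) : ‖radialClamp ρ x‖ ≤ ρ := by
  have h : 0 < max ρ ‖x‖ := lt_max_of_lt_left hρ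
  rw [radialClamp, norm_smul, Real.norm_of_nonneg (by positivity), div_mul_eq_mul_div,
    div_le_iff₀ h]
  gcongr
  exact le_max_right _ _

theorem lipschitzWith_radialClamp {ρ : ℝ} (hρ : 0 < ρ) :
    LipschitzWith 2 (radialClamp ρ : F → F) := by
  refine LipschitzWith.of_dist_le_mul fun x y => ?_
  have hx : 0 < max ρ ‖x‖ := lt_max_of_lt_left hρ
  have hy : 0 < max ρ ‖y‖ := lt_max_of_lt_left hρ
  have hdiff : |max ρ ‖y‖ - max ρ ‖x‖| ≤ ‖x - y‖ := by
    rw [max_comm ρ, max_comm ρ]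
    refine (abs_max_sub_max_le_abs _ _ _).trans ?_
    rw [norm_sub_rev]
    exact abs_norm_sub_norm_le _ _
  have hsplit : radialClamp ρ x - radialClamp ρ y = (ρ / max ρ ‖x‖) • (x - y) +
      (ρ / max ρ ‖x‖ * ((max ρ ‖y‖ - max ρ ‖x‖) / max ρ ‖y‖)) • y := by
    have : ρ / max ρ ‖x‖ * ((max ρ ‖y‖ - max ρ ‖x‖) / max ρ ‖y‖) =
        ρ / max ρ ‖x‖ - ρ / max ρ ‖y‖ := by field_simp
    rw [this, radialClamp, radialClamp]
    module
  have hratio_x : ρ / max ρ ‖x‖ ≤ 1 := (div_le_one hx).2 (le_max_left _ _)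
  have hratio_y : ‖y‖ / max ρ ‖y‖ ≤ 1 := (div_le_one hy).2 (le_max_right _ _)
  rw [dist_eq_norm, dist_eq_norm, hsplit]
  calc _ ≤ ρ / max ρ ‖x‖ * ‖x - y‖ +
        ρ / max ρ ‖x‖ * (|max ρ ‖y‖ - max ρ ‖x‖| / max ρ ‖y‖) * ‖y‖ := by
        refine (norm_add_le _ _).trans (le_of_eq ?_)
        rw [norm_smul, norm_smul, Real.norm_of_nonneg (by positivity), norm_mul,
          Real.norm_of_nonneg (by positivity : 0 ≤ ρ / max ρ ‖x‖), norm_div,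
          Real.norm_of_nonneg hy.le, Real.norm_eq_abs]
    _ = ρ / max ρ ‖x‖ * ‖x - y‖ +
        ρ / max ρ ‖x‖ * (|max ρ ‖y‖ - max ρ ‖x‖| * (‖y‖ / max ρ ‖y‖)) := by ring
    _ ≤ 1 * ‖x - y‖ + 1 * (‖x - y‖ * 1) := by gcongr
    _ = _ := by push_cast; ring

theorem LipschitzOnBounded.exists_eqOn_closedBall {Y : Type} [SeminormedAddCommGroup Y] {g : F → Y}
    (hg : LipschitzOnBounded g) {ρ : ℝ} (hρ : 0 < ρ) :
    ∃ (g' : F → Y) (K M : ℝ≥0), LipschitzWith K g' ∧ (∀ x, ‖g' x‖ ≤ M) ∧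
      EqOn g' g (Metric.closedBall 0 ρ) := by
  have hmem : ∀ x : F, radialClamp ρ x ∈ Metric.closedBall 0 ρ := fun x =>
    mem_closedBall_zero_iff.2 (norm_radialClamp_le hρ x)
  obtain ⟨K, hK⟩ := hg _ (Metric.isBounded_closedBall (x := 0) (r := ρ))
  obtain ⟨M, hM₀, hM⟩ := (hg.isBounded_image
    (Metric.isBounded_closedBall (x := 0) (r := ρ))).exists_pos_norm_le
  refine ⟨g ∘ radialClamp ρ, K * 2, ⟨M, hM₀.le⟩, ?_, fun x => hM _ (mem_image_of_mem g (hmem x)),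
    fun x hx => congrArg g (radialClamp_of_norm_le hρ (mem_closedBall_zero_iff.1 hx))⟩
  rw [← lipschitzOnWith_univ]
  exact hK.comp (lipschitzOnWith_univ.2 (lipschitzWith_radialClamp hρ)) fun x _ => hmem x

end RadialTruncation

/-! ### Histories of continuous functions -/

section Hist

variable {Δ : ℝ} {E : Type} [NormedAddCommGroup E] {x y : ℝ → E} {s : ℝ}

theorem hist_apply_of_continuousOn (hx : ContinuousOn x (Icc (s - Δ) s))
    (θ : Icc (-Δ) (0 : ℝ)) : hist Δ x s θ = x (s + θ) := by
  have h : ContinuousOn (fun θ => x (s + θ)) (Icc (-Δ) 0) :=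
    hx.comp (by fun_prop) fun θ hθ => ⟨by linarith [hθ.1], by linarith [hθ.2]⟩
  simp only [hist, toHist, dif_pos h]
  rfl

theorem hist_apply (hx : Continuous x) (s : ℝ) (θ : Icc (-Δ) (0 : ℝ)) :
    hist Δ x s θ = x (s + θ) := hist_apply_of_continuousOn hx.continuousOn θ

theorem add_coe_mem_Icc (s : ℝ) (θ : Icc (-Δ) (0 : ℝ)) : s + (θ : ℝ) ∈ Icc (s - Δ) s :=
  ⟨by linarith [θ.2.1], by linarith [θ.2.2]⟩

theorem hist_congr (hx : ContinuousOn x (Icc (s - Δ) s)) (h : EqOn x y (Icc (s - Δ) s)) :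
    hist Δ x s = hist Δ y s := by
  ext θ
  rw [hist_apply_of_continuousOn hx, hist_apply_of_continuousOn (hx.congr h.symm),
    h (add_coe_mem_Icc s θ)]

theorem continuous_hist (hx : Continuous x) : Continuous (hist Δ x) := by
  refine ContinuousMap.continuous_of_continuous_uncurry _ ?_
  simp only [hist_apply hx]
  fun_prop

theorem norm_hist_le (hx : Continuous x) {ρ : ℝ} (hρ : 0 ≤ ρ) (h : ∀ v ∈ Icc (s - Δ) s, ‖x v‖ ≤ ρ) :
    ‖hist Δ x s‖ ≤ ρ := by
  refine (ContinuousMap.norm_le _ hρ).2 fun θ => ?_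
  rw [hist_apply hx]
  exact h _ (add_coe_mem_Icc s θ)

theorem norm_hist_sub_le (hx : Continuous x) (hy : Continuous y) {ρ : ℝ} (hρ : 0 ≤ ρ)
    (h : ∀ v ∈ Icc (s - Δ) s, ‖x v - y v‖ ≤ ρ) : ‖hist Δ x s - hist Δ y s‖ ≤ ρ := by
  refine (ContinuousMap.norm_le _ hρ).2 fun θ => ?_
  rw [ContinuousMap.sub_apply, hist_apply hx, hist_apply hy]
  exact h _ (add_coe_mem_Icc s θ)

theorem lipschitzWith_hist {L : ℝ≥0} (hx : LipschitzWith L x) : LipschitzWith L (hist Δ x) := by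
  refine LipschitzWith.of_dist_le_mul fun s s' => ?_
  refine (ContinuousMap.dist_le (by positivity)).2 fun θ => ?_
  rw [hist_apply hx.continuous, hist_apply hx.continuous]
  simpa only [dist_add_right] using hx.dist_le_mul (s + θ) (s' + θ)

theorem hist_comp {F : Type} [NormedAddCommGroup F] (g : C(E, F))
    (hx : ContinuousOn x (Icc (s - Δ) s)) :
    hist Δ (fun u => g (x u)) s = g.comp (hist Δ x s) := by
  ext θ
  have h : ContinuousOn (fun u => g (x u)) (Icc (s - Δ) s) := g.continuous.comp_continuousOn hx
  rw [hist_apply_of_continuousOn h, ContinuousMap.comp_apply, hist_apply_of_continuousOn hx]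

variable [Fact (0 < Δ)]

theorem hist_zeroPt (hx : Continuous x) (s : ℝ) : hist Δ x s (zeroPt Δ) = x s := by
  rw [hist_apply hx]
  simp [zeroPt]

theorem IccExtendCM_coe (φ : Hist Δ E) (θ : Icc (-Δ) (0 : ℝ)) :
    ContinuousMap.IccExtendCM φ (θ : ℝ) = φ θ :=
  ContinuousMap.IccExtendCM_of_mem θ.2

theorem norm_IccExtendCM_le (φ : Hist Δ E) (s : ℝ) : ‖ContinuousMap.IccExtendCM φ s‖ ≤ ‖φ‖ :=
  φ.norm_coe_le_norm _

end Hist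

/-! ### Sampling times -/

/-- The last index `l` with `t l ≤ s`. -/
noncomputable def lastIdx (t : ℕ → ℝ) (s : ℝ) : ℕ := sSup {l : ℕ | t l ≤ s}

/-- The last sampling time not after `s`. -/
noncomputable def lastSample (t : ℕ → ℝ) (s : ℝ) : ℝ := t (lastIdx t s)

/-- A measurable sampling function `σ`, locally constant from the right, with values in `[0, s]` and
delay `s - σ s ≤ δ` for `s ≥ 0`. For negative times the value is `0`, so that no case distinction on
the sign of the time is needed. -/
structure IsSampler (δ : ℝ) (σ : ℝ → ℝ) : Prop where
  measurable : Measurable σ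
  nonneg : ∀ s, 0 ≤ σ s
  le : ∀ s, σ s ≤ max s 0
  sub_le : ∀ s, 0 ≤ s → s - δ ≤ σ s
  eventually_eq : ∀ s, 0 ≤ s → ∀ᶠ s' in 𝓝[≥] s, σ s' = σ s

theorem IsSampler.le_self {δ : ℝ} {σ : ℝ → ℝ} (hσ : IsSampler δ σ) {s : ℝ} (hs : 0 ≤ s) :
    σ s ≤ s := (hσ.le s).trans_eq (max_eq_left hs)

namespace IsPartition

variable {a δ : ℝ} {t : ℕ → ℝ} (ht : IsPartition a δ t) {j : ℕ} {s : ℝ}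
include ht

theorem nonneg (j : ℕ) : 0 ≤ t j := ht.zero ▸ ht.strictMono.monotone (Nat.zero_le j)

theorem exists_mem_Ico (hs : 0 ≤ s) : ∃ j, s ∈ Ico (t j) (t (j + 1)) := by
  have h : ⋃ j, Ico (t j) (t (j + 1)) = Ici (t 0) := iUnion_Ico_map_succ_eq_Ici
    (fun i => ht.strictMono.monotone i.zero_le) (not_bddAbove_of_tendsto_atTop ht.tendsto)
  have hs' : s ∈ Ici (t 0) := ht.zero.trans_le hs
  rwa [← h, mem_iUnion] at hs'

theorem lastIdx_eq (hs : s ∈ Ico (t j) (t (j + 1))) : lastIdx t s = j := by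
  have : {l : ℕ | t l ≤ s} = Iic j := by
    ext l
    refine ⟨fun hl => Nat.lt_succ_iff.1 (ht.strictMono.lt_iff_lt.1 (hl.trans_lt hs.2)),
      fun hl => ?_⟩
    exact (ht.strictMono.monotone hl).trans hs.1
  rw [lastIdx, this, csSup_Iic]

theorem lastSample_eq (hs : s ∈ Ico (t j) (t (j + 1))) : lastSample t s = t j := by
  rw [lastSample, ht.lastIdx_eq hs]

theorem lastIdx_of_neg (hs : s < 0) : lastIdx t s = 0 := by
  have : {l : ℕ | t l ≤ s} = ∅ := eq_empty_of_forall_notMem fun l hl => by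
    linarith [ht.nonneg l, show t l ≤ s from hl]
  rw [lastIdx, this, csSup_empty, bot_eq_zero]

theorem lastIdx_sample (j : ℕ) : lastIdx t (t j) = j :=
  ht.lastIdx_eq ⟨le_rfl, ht.strictMono j.lt_succ_self⟩

theorem lastIdx_mono : Monotone (lastIdx t) := by
  intro s s' hss
  rcases lt_or_ge s 0 with hs | hs
  · exact (ht.lastIdx_of_neg hs).trans_le (Nat.zero_le _)
  · obtain ⟨i, hi⟩ := ht.exists_mem_Ico hs
    obtain ⟨j, hj⟩ := ht.exists_mem_Ico (hs.trans hss)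
    rw [ht.lastIdx_eq hi, ht.lastIdx_eq hj]
    exact Nat.lt_succ_iff.1 (ht.strictMono.lt_iff_lt.1 (hi.1.trans_lt (hss.trans_lt hj.2)))

theorem isSampler : IsSampler δ (lastSample t) where
  measurable := (ht.strictMono.monotone.comp ht.lastIdx_mono).measurable
  nonneg s := ht.nonneg _
  le s := by
    rcases lt_or_ge s 0 with hs | hs
    · simp only [lastSample, ht.lastIdx_of_neg hs, ht.zero, le_max_right]
    · obtain ⟨i, hi⟩ := ht.exists_mem_Ico hs
      exact ht.lastSample_eq hi ▸ hi.1.trans (le_max_left _ _)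
  sub_le s hs := by
    obtain ⟨i, hi⟩ := ht.exists_mem_Ico hs
    rw [ht.lastSample_eq hi]
    linarith [ht.diam i, hi.2]
  eventually_eq s hs := by
    obtain ⟨i, hi⟩ := ht.exists_mem_Ico hs
    filter_upwards [Ico_mem_nhdsGE hi.2] with s' h
    rw [ht.lastSample_eq hi, ht.lastSample_eq ⟨hi.1.trans h.1, h.2⟩]

end IsPartition

/-! ### Sampled Volterra equations -/

/-- The right-hand side `u ↦ A (X_u, X_{σ u})` of the delay equation with velocity field `A` in
which the second argument is held at the sampled times `σ u`. -/
noncomputable def sampledRhs {Δ : ℝ} {E : Type} [NormedAddCommGroup E]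
    (A : Hist Δ E × Hist Δ E → E) (σ : ℝ → ℝ) (X : ℝ → E) (u : ℝ) : E :=
  A (hist Δ X u, hist Δ X (σ u))

/-- `X` solves the sampled delay equation `X'(u) = A (X_u, X_{σ u})` in integrated form at the
times in `S`. -/
def SolvesSampledOn {Δ : ℝ} {E : Type} [NormedAddCommGroup E] [NormedSpace ℝ E]
    (A : Hist Δ E × Hist Δ E → E) (σ : ℝ → ℝ) (X : ℝ → E) (S : Set ℝ) : Prop :=
  ∀ s ∈ S, X s = X 0 + ∫ u in (0 : ℝ)..s, sampledRhs A σ X u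

section SampledRhs

variable {Δ : ℝ} {E : Type} [NormedAddCommGroup E] {A : Hist Δ E × Hist Δ E → E}
  {σ : ℝ → ℝ} {δ : ℝ} {X Y : ℝ → E}

theorem stronglyMeasurable_sampledRhs (hA : Continuous A) (hσ : Measurable σ) (hX : Continuous X) :
    StronglyMeasurable (sampledRhs A σ X) :=
  hA.comp_stronglyMeasurable ((continuous_hist hX).stronglyMeasurable.prodMk
    ((continuous_hist hX).stronglyMeasurable.comp_measurable hσ))

theorem exists_norm_sampledRhs_le (hA : LipschitzOnBounded A) (hσ : IsSampler δ σ)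
    (hX : Continuous X) (c : ℝ) : ∃ M, ∀ u ≤ c, -c ≤ u → ‖sampledRhs A σ X u‖ ≤ M := by
  have hS : Bornology.IsBounded (hist Δ X '' Icc (-c) c) :=
    (isCompact_Icc.image (continuous_hist hX)).isBounded
  obtain ⟨M, -, hM⟩ := (hA.isBounded_image (hS.prod hS)).exists_pos_norm_le
  refine ⟨M, fun u hu hu' => hM _ (mem_image_of_mem A ⟨mem_image_of_mem _ ⟨hu', hu⟩,
    mem_image_of_mem _ ⟨?_, ?_⟩⟩)⟩
  · linarith [hσ.nonneg u]
  · exact (hσ.le u).trans (max_le hu (by linarith))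

theorem intervalIntegrable_sampledRhs (hA : LipschitzOnBounded A) (hσ : IsSampler δ σ)
    (hX : Continuous X) (b c : ℝ) : IntervalIntegrable (sampledRhs A σ X) volume b c := by
  obtain ⟨M, hM⟩ := exists_norm_sampledRhs_le hA hσ hX (max |b| |c|)
  refine (intervalIntegrable_const (c := M)).mono_fun'
    (stronglyMeasurable_sampledRhs hA.continuous hσ.measurable hX).aestronglyMeasurable
    ((ae_restrict_iff' measurableSet_uIoc).2 (.of_forall fun u hu => ?_))
  have hu' := abs_le.1 (abs_le_max_abs_abs hu.1.le hu.2)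
  have hbc : max |min b c| |max b c| ≤ max |b| |c| := by
    rcases le_total b c with h | h <;> simp [h, max_comm]
  exact hM u (hu'.2.trans hbc) (by linarith)

theorem continuousWithinAt_sampledRhs (hA : Continuous A) (hX : Continuous X) {S : Set ℝ} {t : ℝ}
    (h : ∀ᶠ u in 𝓝[S] t, σ u = σ t) : ContinuousWithinAt (sampledRhs A σ X) S t := by
  have hcont : ContinuousWithinAt (fun u => A (hist Δ X u, hist Δ X (σ t))) S t :=
    (hA.comp ((continuous_hist hX).prodMk continuous_const)).continuousWithinAt
  refine hcont.congr_of_eventuallyEq ?_ rfl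
  filter_upwards [h] with u hu
  rw [sampledRhs, hu]

theorem norm_hist_pair_le (hσ : IsSampler δ σ) (hX : Continuous X) {ρ u : ℝ} (hρ : 0 ≤ ρ)
    (hu : 0 ≤ u) (hb : ∀ v ∈ Icc (-Δ) u, ‖X v‖ ≤ ρ) :
    ‖(hist Δ X u, hist Δ X (σ u))‖ ≤ ρ := by
  have hσu : σ u ≤ u := hσ.le_self hu
  exact norm_prod_le_iff.2
    ⟨norm_hist_le hX hρ fun v hv => hb v ⟨by linarith [hv.1], hv.2⟩,
     norm_hist_le hX hρ fun v hv => hb v ⟨by linarith [hσ.nonneg u, hv.1], hv.2.trans hσu⟩⟩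

theorem norm_sampledRhs_sub_le {K : ℝ≥0} (hA : LipschitzWith K A) (hσ : IsSampler δ σ)
    (hX : Continuous X) (hY : Continuous Y) {ρ u : ℝ} (hρ : 0 ≤ ρ) (hu : 0 ≤ u)
    (hXY : ∀ v ∈ Icc (-Δ) u, ‖X v - Y v‖ ≤ ρ) :
    ‖sampledRhs A σ X u - sampledRhs A σ Y u‖ ≤ K * ρ := by
  have hσu : σ u ≤ u := hσ.le_self hu
  refine (hA.norm_sub_le _ _).trans ?_
  gcongr
  exact norm_prod_le_iff.2
    ⟨norm_hist_sub_le hX hY hρ fun v hv => hXY v ⟨by linarith [hv.1], hv.2⟩,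
     norm_hist_sub_le hX hY hρ fun v hv =>
      hXY v ⟨by linarith [hσ.nonneg u, hv.1], hv.2.trans hσu⟩⟩

end SampledRhs

section Volterra

variable {Δ : ℝ} {E : Type} [NormedAddCommGroup E] [NormedSpace ℝ E]
  {A A' : Hist Δ E × Hist Δ E → E} {σ : ℝ → ℝ} {δ : ℝ} {X Y : ℝ → E}

theorem SolvesSampledOn.mono {S S' : Set ℝ} (h : SolvesSampledOn A σ X S) (hS : S' ⊆ S) :
    SolvesSampledOn A σ X S' := fun s hs => h s (hS hs)

theorem SolvesSampledOn.of_eqOn_closedBall {S : Set ℝ} {ρ : ℝ} (h : SolvesSampledOn A σ X S)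
    (hσ : IsSampler δ σ) (hX : Continuous X) (hρ : 0 ≤ ρ) (hS : S ⊆ Ici 0)
    (hb : ∀ s ∈ S, ∀ v ∈ Icc (-Δ) s, ‖X v‖ ≤ ρ) (hAA' : EqOn A A' (Metric.closedBall 0 ρ)) :
    SolvesSampledOn A' σ X S := by
  intro s hs
  rw [h s hs]
  congr 1
  refine intervalIntegral.integral_congr fun u hu => hAA' (mem_closedBall_zero_iff.2 ?_)
  rw [uIcc_of_le (hS hs)] at hu
  exact norm_hist_pair_le hσ hX hρ hu.1 fun v hv => hb s hs v ⟨hv.1, hv.2.trans hu.2⟩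

theorem integral_exp_mul_le {l C : ℝ} (hl : 0 < l) (hC : 0 ≤ C) (s : ℝ) :
    ∫ u in (0 : ℝ)..s, C * Real.exp (l * u) ≤ C / l * Real.exp (l * s) := by
  rw [intervalIntegral.integral_const_mul, intervalIntegral.integral_comp_mul_left _ hl.ne',
    integral_exp, mul_zero, Real.exp_zero, smul_eq_mul, ← mul_assoc, ← div_eq_mul_inv]
  gcongr
  linarith

theorem norm_integral_sampledRhs_sub_le {K : ℝ≥0} (hA : LipschitzWith K A)
    (hσ : IsSampler δ σ) (hX : Continuous X) (hY : Continuous Y) {l m c : ℝ} (hl : 0 < l)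
    (hm : 0 ≤ m) (hc : 0 ≤ c)
    (hXY : ∀ u ∈ Icc (-Δ) c, ‖X u - Y u‖ ≤ m * Real.exp (l * max u 0)) :
    ‖(∫ u in (0 : ℝ)..c, sampledRhs A σ X u) - ∫ u in (0 : ℝ)..c, sampledRhs A σ Y u‖ ≤
      K * m / l * Real.exp (l * c) := by
  have hA' := LipschitzOnBounded.of_lipschitzWith hA
  rw [← intervalIntegral.integral_sub (intervalIntegrable_sampledRhs hA' hσ hX _ _)
    (intervalIntegrable_sampledRhs hA' hσ hY _ _)]
  refine (intervalIntegral.norm_integral_le_of_norm_le hc (g := fun u => K * m * Real.exp (l * u))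
    (.of_forall fun u hu => ?_) (Continuous.intervalIntegrable (by fun_prop) _ _)).trans
    (integral_exp_mul_le hl (by positivity) _)
  rw [mul_assoc]
  refine norm_sampledRhs_sub_le hA hσ hX hY (by positivity) hu.1.le fun v hv =>
    (hXY v ⟨hv.1, hv.2.trans hu.2⟩).trans ?_
  gcongr
  exact max_le hv.2 hu.1.le

/-! #### Uniqueness -/

section Unique

variable [Fact (0 < Δ)]

-- At a maximum point `s₀` of `exp (-(K + 1) s) ‖X s - Y s‖` the integral estimate bounds the
-- maximum by `K / (K + 1)` times itself.
theorem SolvesSampledOn.eqOn_of_lipschitzWith {K : ℝ≥0} {c : ℝ} (hA : LipschitzWith K A)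
    (hσ : IsSampler δ σ) (hX : Continuous X) (hY : Continuous Y) (h₀ : EqOn X Y (Icc (-Δ) 0))
    (hXs : SolvesSampledOn A σ X (Icc 0 c)) (hYs : SolvesSampledOn A σ Y (Icc 0 c)) :
    EqOn X Y (Icc 0 c) := by
  intro s hs
  have hl : (0 : ℝ) < K + 1 := by positivity
  obtain ⟨s₀, hs₀, hmax⟩ := (isCompact_Icc (a := (0 : ℝ)) (b := c)).exists_isMaxOn ⟨s, hs⟩
    (f := fun s => Real.exp (-((K + 1) * s)) * ‖X s - Y s‖) (by fun_prop)
  set m : ℝ := Real.exp (-((K + 1) * s₀)) * ‖X s₀ - Y s₀‖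
  have hm : 0 ≤ m := by positivity
  have hb : ∀ u ∈ Icc 0 c, ‖X u - Y u‖ ≤ m * Real.exp ((K + 1) * u) := fun u hu => by
    have : Real.exp (-((K + 1) * u)) * ‖X u - Y u‖ ≤ m := hmax hu
    rwa [Real.exp_neg, inv_mul_le_iff₀ (Real.exp_pos _), mul_comm] at this
  have hb' : ∀ u ∈ Icc (-Δ) s₀, ‖X u - Y u‖ ≤ m * Real.exp ((K + 1) * max u 0) := fun u hu => by
    rcases le_total u 0 with h | h
    · rw [h₀ ⟨hu.1, h⟩, sub_self, norm_zero]
      positivity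
    · rw [max_eq_left h]
      exact hb u ⟨h, hu.2.trans hs₀.2⟩
  have hint := norm_integral_sampledRhs_sub_le hA hσ hX hY hl hm hs₀.1 hb'
  have hsub : X s₀ - Y s₀ = (∫ u in (0 : ℝ)..s₀, sampledRhs A σ X u) -
      ∫ u in (0 : ℝ)..s₀, sampledRhs A σ Y u := by
    rw [hXs s₀ hs₀, hYs s₀ hs₀, h₀ (x := 0) (zeroPt Δ).2, add_sub_add_left_eq_sub]
  have hm_le : m ≤ K * m / (K + 1) := by
    rwa [← hsub, ← div_le_iff₀ (Real.exp_pos _), div_eq_inv_mul, ← Real.exp_neg] at hint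
  have hm_zero : m = 0 := le_antisymm (by rw [le_div_iff₀ hl] at hm_le; linarith) hm
  have := hb s hs
  rw [hm_zero, zero_mul] at this
  exact sub_eq_zero.1 (norm_le_zero_iff.1 this)

theorem SolvesSampledOn.eqOn {c : ℝ} (hA : LipschitzOnBounded A) (hσ : IsSampler δ σ)
    (hX : Continuous X) (hY : Continuous Y) (h₀ : EqOn X Y (Icc (-Δ) 0))
    (hXs : SolvesSampledOn A σ X (Icc 0 c)) (hYs : SolvesSampledOn A σ Y (Icc 0 c)) :
    EqOn X Y (Icc 0 c) := by
  obtain ⟨B, hB⟩ := (isCompact_Icc (a := -Δ) (b := c)).exists_bound_of_continuousOn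
    (f := fun s => (X s, Y s)) (by fun_prop)
  have hρ : 0 < max B 1 := lt_max_of_lt_right one_pos
  obtain ⟨A', K, -, hA'K, -, hA'A⟩ := hA.exists_eqOn_closedBall hρ
  have hb : ∀ s ∈ Icc 0 c, ∀ v ∈ Icc (-Δ) s, ‖(X v, Y v)‖ ≤ max B 1 := fun s hs v hv =>
    (hB v ⟨hv.1, hv.2.trans hs.2⟩).trans (le_max_left _ _)
  exact SolvesSampledOn.eqOn_of_lipschitzWith hA'K hσ hX hY h₀
    (hXs.of_eqOn_closedBall hσ hX hρ.le (fun _ hs => hs.1)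
      (fun s hs v hv => (norm_fst_le (X v, Y v)).trans (hb s hs v hv)) hA'A.symm)
    (hYs.of_eqOn_closedBall hσ hY hρ.le (fun _ hs => hs.1)
      (fun s hs v hv => (norm_snd_le (X v, Y v)).trans (hb s hs v hv)) hA'A.symm)

end Unique

/-! #### Existence -/

section Picard

open BoundedContinuousFunction

/-- The path `φ s + exp (l max(s, 0)) y s` with exponentially weighted deviation `y` from `φ`. -/
noncomputable def weightedPath (l : ℝ) (φ : C(ℝ, E)) (y : ℝ →ᵇ E) (s : ℝ) : E :=
  φ s + Real.exp (l * max s 0) • y s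

/-- The Picard operator of the sampled delay equation in terms of the weighted deviation `y`; it is
a contraction of the supremum norm when `l` exceeds the Lipschitz constant of `A`. -/
noncomputable def weightedPicard (A : Hist Δ E × Hist Δ E → E) (σ : ℝ → ℝ) (l : ℝ) (φ : C(ℝ, E))
    (y : ℝ →ᵇ E) (s : ℝ) : E :=
  Real.exp (-(l * max s 0)) •
    ∫ u in (0 : ℝ)..max s 0, sampledRhs A σ (weightedPath l φ y) u

theorem continuous_weightedPath (l : ℝ) (φ : C(ℝ, E)) (y : ℝ →ᵇ E) :
    Continuous (weightedPath l φ y) := by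
  unfold weightedPath
  fun_prop

theorem continuous_weightedPicard (hA : LipschitzOnBounded A) (hσ : IsSampler δ σ) (l : ℝ)
    (φ : C(ℝ, E)) (y : ℝ →ᵇ E) : Continuous (weightedPicard A σ l φ y) := by
  have := intervalIntegral.continuous_primitive
    (intervalIntegrable_sampledRhs hA hσ (continuous_weightedPath l φ y)) 0
  unfold weightedPicard
  fun_prop

theorem norm_weightedPicard_le {l : ℝ} (hl : 0 < l) {M : ℝ≥0} (hM : ∀ p, ‖A p‖ ≤ M)
    (φ : C(ℝ, E)) (y : ℝ →ᵇ E) (s : ℝ) : ‖weightedPicard A σ l φ y s‖ ≤ M / l := by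
  have hu : 0 ≤ max s 0 := le_max_right _ _
  rw [weightedPicard]
  set u := max s 0
  have hint : ‖∫ v in (0 : ℝ)..u, sampledRhs A σ (weightedPath l φ y) v‖ ≤ M * |u - 0| :=
    intervalIntegral.norm_integral_le_of_norm_le_const fun _ _ => hM _
  rw [norm_smul, Real.norm_of_nonneg (Real.exp_pos _).le, Real.exp_neg,
    inv_mul_le_iff₀ (Real.exp_pos _)]
  calc _ ≤ M / l * (l * u) := hint.trans (le_of_eq (by rw [sub_zero, abs_of_nonneg hu]; field_simp))
    _ ≤ M / l * Real.exp (l * u) := by gcongr; linarith [Real.add_one_le_exp (l * u)]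
    _ = _ := mul_comm _ _

theorem dist_weightedPicard_le {K : ℝ≥0} (hA : LipschitzWith K A) (hσ : IsSampler δ σ) {l : ℝ}
    (hl : 0 < l) (φ : C(ℝ, E)) (y y' : ℝ →ᵇ E) (s : ℝ) :
    dist (weightedPicard A σ l φ y s) (weightedPicard A σ l φ y' s) ≤ K / l * dist y y' := by
  have hdev : ∀ v ∈ Icc (-Δ) (max s 0), ‖weightedPath l φ y v - weightedPath l φ y' v‖ ≤
      dist y y' * Real.exp (l * max v 0) := fun v _ => by
    rw [weightedPath, weightedPath, add_sub_add_left_eq_sub, ← smul_sub, norm_smul,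
      Real.norm_of_nonneg (Real.exp_pos _).le, mul_comm, ← dist_eq_norm]
    gcongr
    exact dist_coe_le_dist v
  have hint := norm_integral_sampledRhs_sub_le hA hσ (continuous_weightedPath l φ y)
    (continuous_weightedPath l φ y') hl dist_nonneg (le_max_right s 0) hdev
  rw [dist_eq_norm, weightedPicard, weightedPicard, ← smul_sub, norm_smul,
    Real.norm_of_nonneg (Real.exp_pos _).le, Real.exp_neg, inv_mul_le_iff₀ (Real.exp_pos _)]
  exact hint.trans (le_of_eq (by ring))

theorem exists_eq_weightedPicard [CompleteSpace E] {K M : ℝ≥0} (hA : LipschitzWith K A)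
    (hM : ∀ p, ‖A p‖ ≤ M) (hσ : IsSampler δ σ) (φ : C(ℝ, E)) :
    ∃ (l : ℝ) (y : ℝ →ᵇ E), ∀ s, y s = weightedPicard A σ l φ y s := by
  have hl : (0 : ℝ) < K + 1 := by positivity
  let N : (ℝ →ᵇ E) → ℝ →ᵇ E := fun y => ofNormedAddCommGroup (weightedPicard A σ (K + 1) φ y)
    (continuous_weightedPicard (.of_lipschitzWith hA) hσ _ φ y) (M / (K + 1))
    (norm_weightedPicard_le hl hM φ y)
  have hN : ContractingWith (K / (K + 1)) N := by
    refine ⟨(div_lt_one (by positivity)).2 (lt_add_one K), LipschitzWith.of_dist_le_mul ?_⟩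
    intro y y'
    exact (dist_le (by positivity)).2 (dist_weightedPicard_le hA hσ hl φ y y')
  exact ⟨K + 1, hN.fixedPoint N, fun s => congrArg (· s) hN.fixedPoint_isFixedPt.symm⟩

end Picard

theorem exists_solvesSampledOn [CompleteSpace E] {K M : ℝ≥0} (hA : LipschitzWith K A)
    (hM : ∀ p, ‖A p‖ ≤ M) (hσ : IsSampler δ σ) (φ : C(ℝ, E)) :
    ∃ X : ℝ → E, Continuous X ∧ EqOn X φ (Iic 0) ∧ SolvesSampledOn A σ X (Ici 0) := by
  obtain ⟨l, y, hy⟩ := exists_eq_weightedPicard hA hM hσ (φ.comp ⟨fun s => min s 0, by fun_prop⟩)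
  set X := weightedPath l (φ.comp ⟨fun s => min s 0, by fun_prop⟩) y with hX_def
  have hX : ∀ s, X s = φ (min s 0) + ∫ u in (0 : ℝ)..max s 0, sampledRhs A σ X u := by
    intro s
    nth_rw 1 [hX_def]
    rw [weightedPath, hy, weightedPicard, smul_smul, ← Real.exp_add, add_neg_cancel, Real.exp_zero,
      one_smul]
    rfl
  have hX₀ : EqOn X φ (Iic 0) := fun s hs => by
    rw [hX s, min_eq_left hs, max_eq_right hs, intervalIntegral.integral_same, add_zero]
  refine ⟨X, continuous_weightedPath _ _ _, hX₀, fun s hs => ?_⟩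
  rw [hX s, min_eq_right hs, max_eq_left hs, hX₀ self_mem_Iic]

/-! #### Regularity -/

theorem SolvesSampledOn.hasDerivWithinAt [CompleteSpace E] (hXs : SolvesSampledOn A σ X (Ici 0))
    (hA : LipschitzOnBounded A) (hσ : IsSampler δ σ) (hX : Continuous X) {t : ℝ} (ht : 0 ≤ t) :
    HasDerivWithinAt X (sampledRhs A σ X t) (Ici t) t := by
  have h := (intervalIntegral.integral_hasDerivWithinAt_right
    (intervalIntegrable_sampledRhs hA hσ hX 0 t) (s := Ici t) (t := Ioi t)
    (stronglyMeasurable_sampledRhs hA.continuous hσ.measurable hX).stronglyMeasurableAtFilter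
    (continuousWithinAt_sampledRhs hA.continuous hX
      (nhdsWithin_mono t Ioi_subset_Ici_self (hσ.eventually_eq t ht)))).const_add (X 0)
  exact h.congr (fun s hs => hXs s (ht.trans hs)) (hXs t ht)

theorem lipschitzWith_primitive {g : ℝ → E} {M : ℝ≥0} (hg : ∀ u, ‖g u‖ ≤ M)
    (hgi : ∀ b c, IntervalIntegrable g volume b c) :
    LipschitzWith M fun s : ℝ => ∫ u in (0 : ℝ)..s, g u := by
  refine LipschitzWith.of_dist_le_mul fun s s' => ?_
  rw [dist_eq_norm, intervalIntegral.integral_interval_sub_left (hgi _ _) (hgi _ _), Real.dist_eq]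
  exact intervalIntegral.norm_integral_le_of_norm_le_const fun _ _ => hg _

theorem SolvesSampledOn.lipschitzWith {L M : ℝ≥0} (hXs : SolvesSampledOn A σ X (Ici 0))
    (hA : LipschitzOnBounded A) (hM : ∀ p, ‖A p‖ ≤ M) (hσ : IsSampler δ σ) (hX : Continuous X)
    (hL : LipschitzOnWith L X (Iic 0)) : LipschitzWith (L + M) X := by
  have hpast : LipschitzWith L fun s => X (min s 0) := by
    have := hL.comp (LipschitzWith.id.min_const 0).lipschitzOnWith (s := univ) fun s _ =>
      min_le_right s 0
    rwa [mul_one, lipschitzOnWith_univ] at this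
  have hfuture := (lipschitzWith_primitive (fun u => hM (hist Δ X u, hist Δ X (σ u)))
    (intervalIntegrable_sampledRhs hA hσ hX)).comp (LipschitzWith.id.max_const 0)
  rw [mul_one] at hfuture
  have hsum : X = fun s => X (min s 0) + ∫ u in (0 : ℝ)..max s 0, sampledRhs A σ X u := by
    funext s
    rcases le_total s 0 with hs | hs
    · simp [min_eq_left hs, max_eq_right hs]
    · simp [min_eq_right hs, max_eq_left hs, ← hXs s hs]
  exact hsum ▸ hpast.add hfuture

end Volterra

/-! ### Decay of a scalar function from intermittent rates -/

/-- The lower right Dini derivative of `w` at `t` is at most `k`, in the form used by the mean value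
inequalities of Mathlib. -/
def LowerDiniLE (w : ℝ → ℝ) (t k : ℝ) : Prop :=
  ∀ r, k < r → ∃ᶠ z in 𝓝[>] t, slope w t z < r

theorem LowerDiniLE.mono {w : ℝ → ℝ} {t k k' : ℝ} (h : LowerDiniLE w t k) (hk : k ≤ k') :
    LowerDiniLE w t k' := fun r hr => h r (hk.trans_lt hr)

theorem le_add_of_lowerDiniLE {w : ℝ → ℝ} {p q k : ℝ} (hpq : p ≤ q)
    (hw : ContinuousOn w (Icc p q)) (h : ∀ t ∈ Ico p q, LowerDiniLE w t k) :
    w q ≤ w p + k * (q - p) :=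
  image_le_of_liminf_slope_right_le_deriv_boundary (B := fun s => w p + k * (s - p))
    (B' := fun _ => k) hw (by simp) (by fun_prop)
    (fun u _ => by simpa using
      ((((hasDerivAt_id u).sub_const p).const_mul k).const_add (w p)).hasDerivWithinAt)
    h (right_mem_Icc.2 hpq)

/-- On `[0, c]` the function `w` grows at most at the rate `ε`; after each time in `D` it decreases
at the rate `a - ε` for the time `l`; and it is at most `b / 2` at the end of every time window of
length `Δ` that avoids `D`. The last two conditions make the growth negligible during the time
`Δ + l`. -/
structure PracticalDecay (w : ℝ → ℝ) (D : Set ℝ) (Δ l a ε b c : ℝ) : Prop where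
  continuousOn : ContinuousOn w (Icc 0 c)
  lowerDiniLE : ∀ t ∈ Ico 0 c, LowerDiniLE w t ε
  lowerDiniLE_of_mem : ∀ u ∈ Ico 0 c ∩ D, ∀ t ∈ Ico u (u + l), t < c → LowerDiniLE w t (ε - a)
  le_of_disjoint : ∀ t ∈ Icc Δ c, Disjoint (Icc (t - Δ) t) D → w t ≤ b / 2
  window_pos : 0 < Δ
  duration_pos : 0 < l
  rate_pos : 0 < a
  error_nonneg : 0 ≤ ε
  error_le_drop : ε * (Δ + l) ≤ a * l / 2
  error_le_bound : ε * (Δ + l) ≤ b / 4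

namespace PracticalDecay

variable {w : ℝ → ℝ} {D : Set ℝ} {Δ l a ε b c : ℝ} (h : PracticalDecay w D Δ l a ε b c)
include h

theorem period_pos : 0 < Δ + l := add_pos h.window_pos h.duration_pos

theorem drop_pos : 0 < a * l / 2 := half_pos (mul_pos h.rate_pos h.duration_pos)

theorem growth {t t' : ℝ} (ht : 0 ≤ t) (htt : t ≤ t') (ht' : t' ≤ c) :
    w t' ≤ w t + ε * (t' - t) :=
  le_add_of_lowerDiniLE htt (h.continuousOn.mono (Icc_subset_Icc ht ht')) fun u hu =>
    h.lowerDiniLE u ⟨ht.trans hu.1, hu.2.trans_le ht'⟩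

theorem drop {u : ℝ} (hu : 0 ≤ u) (huc : u + l ≤ c) (huD : u ∈ D) :
    w (u + l) ≤ w u + (ε - a) * l := by
  have hl := h.duration_pos
  have := le_add_of_lowerDiniLE (by linarith) (h.continuousOn.mono (Icc_subset_Icc hu huc))
    fun t ht => h.lowerDiniLE_of_mem u ⟨⟨hu, by linarith⟩, huD⟩ t ht (ht.2.trans_le huc)
  rwa [add_sub_cancel_left] at this

theorem window_of_disjoint {t : ℝ} (ht : 0 ≤ t) (htc : t + (Δ + l) ≤ c)
    (hD : Disjoint (Icc t (t + Δ)) D) : w (t + (Δ + l)) ≤ 3 * b / 4 := by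
  have hΔ := h.window_pos
  have hl := h.duration_pos
  have hsmall := h.le_of_disjoint (t + Δ) ⟨by linarith, by linarith⟩ (by simpa using hD)
  have hgrow := h.growth (t := t + Δ) (t' := t + (Δ + l)) (by linarith) (by linarith) htc
  have hερ : ε * (t + (Δ + l) - (t + Δ)) ≤ ε * (Δ + l) :=
    mul_le_mul_of_nonneg_left (by linarith) h.error_nonneg
  linarith [h.error_le_bound]

theorem window_of_mem {t u : ℝ} (ht : 0 ≤ t) (htc : t + (Δ + l) ≤ c) (hu : u ∈ Icc t (t + Δ))
    (huD : u ∈ D) : w (t + (Δ + l)) ≤ w t - a * l / 2 := by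
  have hl := h.duration_pos
  have hbefore := h.growth ht hu.1 (by linarith [hu.2])
  have hdrop := h.drop (ht.trans hu.1) (by linarith [hu.2]) huD
  have hafter := h.growth (t := u + l) (t' := t + (Δ + l)) (by linarith [hu.1])
    (by linarith [hu.2]) htc
  linarith [h.error_le_drop]

theorem window {t : ℝ} (ht : 0 ≤ t) (htc : t + (Δ + l) ≤ c) :
    w (t + (Δ + l)) ≤ max (w t - a * l / 2) (3 * b / 4) := by
  by_cases hD : Disjoint (Icc t (t + Δ)) D
  · exact le_max_of_le_right (h.window_of_disjoint ht htc hD)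
  · obtain ⟨u, hu, huD⟩ := not_disjoint_iff.1 hD
    exact le_max_of_le_left (h.window_of_mem ht htc hu huD)

theorem le_at_multiple (k : ℕ) (hk : k * (Δ + l) ≤ c) :
    w (k * (Δ + l)) ≤ max (w 0 - k * (a * l / 2)) (3 * b / 4) := by
  have hκ := h.drop_pos
  have hτ := h.period_pos
  induction k with
  | zero => simp
  | succ k ih =>
    push_cast at hk ⊢
    rw [add_mul, one_mul] at hk ⊢
    refine (h.window (by positivity) hk).trans (max_le ?_ (le_max_right _ _))
    rcases le_max_iff.1 (ih (by linarith)) with hle | hle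
    · exact le_max_of_le_left (by linarith)
    · exact le_max_of_le_right (by linarith)

theorem le_floor {t : ℝ} (ht : t ∈ Icc 0 c) :
    w t ≤ max (w 0 - ⌊t / (Δ + l)⌋₊ * (a * l / 2)) (3 * b / 4) + b / 4 := by
  have hτ := h.period_pos
  have hfloor : ⌊t / (Δ + l)⌋₊ * (Δ + l) ≤ t :=
    (le_div_iff₀ hτ).1 (Nat.floor_le (div_nonneg ht.1 hτ.le))
  have hlt : t < (⌊t / (Δ + l)⌋₊ + 1) * (Δ + l) := (div_lt_iff₀ hτ).1 (Nat.lt_floor_add_one _)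
  have hrest : ε * (t - ⌊t / (Δ + l)⌋₊ * (Δ + l)) ≤ ε * (Δ + l) :=
    mul_le_mul_of_nonneg_left (by linarith) h.error_nonneg
  linarith [h.le_at_multiple _ (hfloor.trans ht.2), h.growth (by positivity) hfloor ht.2,
    h.error_le_bound]

theorem bound_nonneg : 0 ≤ b := by
  linarith [mul_nonneg h.error_nonneg h.period_pos.le, h.error_le_bound]

theorem le_add {w₀ t : ℝ} (hw₀ : w 0 ≤ w₀) (hw₀' : 0 ≤ w₀) (ht : t ∈ Icc 0 c) :
    w t ≤ w₀ + b := by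
  have hb := h.bound_nonneg
  have hdrop : 0 ≤ ⌊t / (Δ + l)⌋₊ * (a * l / 2) := mul_nonneg (Nat.cast_nonneg _) h.drop_pos.le
  have hmax : max (w 0 - ⌊t / (Δ + l)⌋₊ * (a * l / 2)) (3 * b / 4) ≤ w₀ + 3 * b / 4 :=
    max_le (by linarith) (by linarith)
  linarith [h.le_floor ht]

theorem le_of_large {w₀ t : ℝ} (hw₀ : w 0 ≤ w₀) (ht : t ∈ Icc 0 c)
    (htT : (w₀ / (a * l / 2) + 1) * (Δ + l) ≤ t) : w t ≤ b := by
  have hb := h.bound_nonneg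
  have hdrop : w₀ ≤ ⌊t / (Δ + l)⌋₊ * (a * l / 2) := by
    rw [← div_le_iff₀ h.drop_pos]
    rw [← le_div_iff₀ h.period_pos] at htT
    linarith [Nat.lt_floor_add_one (t / (Δ + l))]
  have hmax : max (w 0 - ⌊t / (Δ + l)⌋₊ * (a * l / 2)) (3 * b / 4) ≤ 3 * b / 4 :=
    max_le (by linarith) le_rfl
  linarith [h.le_floor ht]

end PracticalDecay

/-! ### Driver's derivative along solutions -/

section Dini

variable {Δ : ℝ} [Fact (0 < Δ)] {E : Type} [NormedAddCommGroup E] [NormedSpace ℝ E]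
  {X : ℝ → E} {t : ℝ} {v : E}

theorem hist_add_sub_driverShift_apply (hX : Continuous X) {h : ℝ} (hh : 0 ≤ h)
    (θ : Icc (-Δ) (0 : ℝ)) :
    (hist Δ X (t + h) - driverShift (hist Δ X t) h v) θ =
      if (θ : ℝ) < -h then 0 else X (t + (θ + h)) - X t - ((θ : ℝ) + h) • v := by
  rw [ContinuousMap.sub_apply, hist_apply hX]
  change X (t + h + θ) - (if (θ : ℝ) < -h then _ else _) = _
  have hsum : t + h + θ = t + (θ + h) := by ring
  split_ifs with hθ
  · have hmem : (θ : ℝ) + h ∈ Icc (-Δ) (0 : ℝ) := ⟨by linarith [θ.2.1], by linarith⟩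
    rw [ContinuousMap.IccExtendCM_of_mem hmem, hist_apply hX, hsum, sub_self]
  · rw [hist_zeroPt hX, hsum, sub_sub]

theorem isLittleO_hist_add_sub_driverShift (hX : Continuous X)
    (hv : HasDerivWithinAt X v (Ici t) t) :
    (fun h => hist Δ X (t + h) - driverShift (hist Δ X t) h v) =o[𝓝[>] 0] fun h : ℝ => h := by
  refine Asymptotics.isLittleO_iff.2 fun η hη => ?_
  obtain ⟨e, he, hsub⟩ := mem_nhdsGE_iff_exists_Ico_subset.1
    ((hasDerivWithinAt_iff_isLittleO.1 hv).bound hη)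
  filter_upwards [Ioo_mem_nhdsGT (sub_pos.2 he)] with h hh
  rw [Real.norm_of_nonneg hh.1.le]
  refine (ContinuousMap.norm_le _ (mul_nonneg hη.le hh.1.le)).2 fun θ => ?_
  rw [hist_add_sub_driverShift_apply hX hh.1.le]
  split_ifs with hθ
  · rw [norm_zero]
    exact mul_nonneg hη.le hh.1.le
  · have hbound : ‖X (t + (θ + h)) - X t - (t + (θ + h) - t) • v‖ ≤ η * ‖t + (θ + h) - t‖ :=
      hsub ⟨by linarith, by linarith [θ.2.2, hh.2]⟩
    rw [add_sub_cancel_left, Real.norm_of_nonneg (by linarith)] at hbound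
    exact hbound.trans (mul_le_mul_of_nonneg_left (by linarith [θ.2.2]) hη.le)

omit [Fact (0 < Δ)] [NormedSpace ℝ E] in
theorem tendsto_hist_add (hX : Continuous X) :
    Tendsto (fun h => hist Δ X (t + h)) (𝓝[>] 0) (𝓝 (hist Δ X t)) := by
  have hcont : ContinuousAt (fun h => hist Δ X (t + h)) 0 :=
    ((continuous_hist hX).comp (continuous_const_add t)).continuousAt
  simpa using hcont.tendsto.mono_left nhdsWithin_le_nhds

theorem tendsto_driverShift_hist (hX : Continuous X) (hv : HasDerivWithinAt X v (Ici t) t) :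
    Tendsto (fun h => driverShift (hist Δ X t) h v) (𝓝[>] 0) (𝓝 (hist Δ X t)) := by
  have hdiff := (isLittleO_hist_add_sub_driverShift (Δ := Δ) hX hv).trans_tendsto
    (tendsto_id.mono_left nhdsWithin_le_nhds)
  simpa using (tendsto_hist_add (t := t) hX).sub hdiff

theorem isBigO_sub_of_locallyLipschitz {F : Type} [SeminormedAddCommGroup F] {V : F → ℝ}
    (hV : LocallyLipschitz V) {ι : Type} {u w : ι → F} {lf : Filter ι} {φ : F}
    (hu : Tendsto u lf (𝓝 φ)) (hw : Tendsto w lf (𝓝 φ)) :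
    (fun i => V (u i) - V (w i)) =O[lf] fun i => u i - w i := by
  obtain ⟨K, U, hU, hK⟩ := hV φ
  refine Asymptotics.IsBigO.of_bound K ?_
  filter_upwards [hu hU, hw hU] with i hui hwi
  simpa only [dist_eq_norm] using hK.dist_le_mul _ hui _ hwi

theorem lowerDiniLE_of_driverDeriv_le {V : Hist Δ E → ℝ} (hV : LocallyLipschitz V)
    (hX : Continuous X) (hv : HasDerivWithinAt X v (Ici t) t) {k : ℝ}
    (hk : driverDeriv V (hist Δ X t) v ≤ (k : EReal)) :
    LowerDiniLE (fun s => V (hist Δ X s)) t k := by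
  intro r hr
  obtain ⟨c, hkc, hcr⟩ := exists_between hr
  have hslope : ∀ᶠ h in 𝓝[>] (0 : ℝ),
      (((V (driverShift (hist Δ X t) h v) - V (hist Δ X t)) / h : ℝ) : EReal) < (c : EReal) :=
    eventually_lt_of_limsup_lt (hk.trans_lt (EReal.coe_lt_coe_iff.2 hkc))
  have herr : (fun h => V (hist Δ X (t + h)) - V (driverShift (hist Δ X t) h v))
      =o[𝓝[>] 0] fun h : ℝ => h :=
    (isBigO_sub_of_locallyLipschitz hV (tendsto_hist_add hX)
      (tendsto_driverShift_hist hX hv)).trans_isLittleO (isLittleO_hist_add_sub_driverShift hX hv)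
  have hmain : ∀ᶠ h in 𝓝[>] (0 : ℝ), (V (hist Δ X (t + h)) - V (hist Δ X t)) / h < r := by
    filter_upwards [hslope, herr.bound (sub_pos.2 hcr), self_mem_nhdsWithin] with h hh hb hpos
    rw [EReal.coe_lt_coe_iff, div_lt_iff₀ hpos] at hh
    rw [div_lt_iff₀ hpos]
    rw [Real.norm_of_nonneg (le_of_lt hpos)] at hb
    linarith [(Real.le_norm_self _).trans hb]
  have hshift : Tendsto (fun z => z - t) (𝓝[>] t) (𝓝[>] 0) := by
    rw [tendsto_nhdsWithin_iff]
    refine ⟨?_, ?_⟩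
    · exact tendsto_sub_nhds_zero_iff.2 (tendsto_id.mono_left nhdsWithin_le_nhds)
    · filter_upwards [self_mem_nhdsWithin] with z hz using sub_pos.2 (mem_Ioi.1 hz)
  refine Eventually.frequently ?_
  filter_upwards [hshift.eventually hmain] with z hz
  simpa only [slope_def_field, add_sub_cancel] using hz

end Dini

section Separable

theorem limsup_add_of_tendsto {ι : Type} {lf : Filter ι} [NeBot lf] {u w : ι → EReal} {a : EReal}
    (hu : Tendsto u lf (𝓝 a)) (hbot : a ≠ ⊥) (htop : a ≠ ⊤) :
    limsup (fun i => u i + w i) lf = a + limsup w lf := by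
  refine le_antisymm ?_ ?_
  · have := EReal.limsup_add_le (u := u) (v := w) (f := lf) (.inl (hu.limsup_eq ▸ hbot))
      (.inl (hu.limsup_eq ▸ htop))
    rwa [hu.limsup_eq] at this
  · have := EReal.le_limsup_add (u := w) (v := u) (f := lf)
    rwa [hu.liminf_eq, add_comm, add_comm w u] at this

variable {Δ : ℝ} [Fact (0 < Δ)] {E : Type} [NormedAddCommGroup E] [NormedSpace ℝ E]
  {φ : Hist Δ E} {v : E}

theorem driverShift_zeroPt {h : ℝ} (hh : 0 ≤ h) :
    driverShift φ h v (zeroPt Δ) = φ (zeroPt Δ) + h • v := by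
  change (if (0 : ℝ) < -h then _ else φ (zeroPt Δ) + ((0 : ℝ) + h) • v) = _
  rw [if_neg (by linarith), zero_add]

theorem tendsto_slope_comp_zeroPt {V₁ : E → ℝ} (hV₁ : DifferentiableAt ℝ V₁ (φ (zeroPt Δ))) :
    Tendsto (fun h => (V₁ (driverShift φ h v (zeroPt Δ)) - V₁ (φ (zeroPt Δ))) / h) (𝓝[>] 0)
      (𝓝 (fderiv ℝ V₁ (φ (zeroPt Δ)) v)) := by
  refine (hV₁.hasFDerivAt.hasLineDerivAt v).tendsto_slope_zero_right.congr' ?_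
  filter_upwards [self_mem_nhdsWithin] with h hh
  rw [driverShift_zeroPt (le_of_lt hh), smul_eq_mul, inv_mul_eq_div]

theorem driverDeriv_comp_zeroPt_add {V₁ : E → ℝ} {V₂ : Hist Δ E → ℝ} {g : ℝ}
    (hV₁ : DifferentiableAt ℝ V₁ (φ (zeroPt Δ))) (hV₂ : driverDeriv V₂ φ v = g) :
    driverDeriv (fun ψ => V₁ (ψ (zeroPt Δ)) + V₂ ψ) φ v =
      ((fderiv ℝ V₁ (φ (zeroPt Δ)) v + g : ℝ) : EReal) := by
  have hslope : Tendsto (fun h =>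
      (((V₁ (driverShift φ h v (zeroPt Δ)) - V₁ (φ (zeroPt Δ))) / h : ℝ) : EReal))
      (𝓝[>] 0) (𝓝 (fderiv ℝ V₁ (φ (zeroPt Δ)) v : EReal)) :=
    (continuous_coe_real_ereal.tendsto _).comp (tendsto_slope_comp_zeroPt hV₁)
  unfold driverDeriv at hV₂ ⊢
  simp only [add_sub_add_comm, add_div, EReal.coe_add]
  rw [← hV₂]
  exact limsup_add_of_tendsto hslope (EReal.coe_ne_bot _) (EReal.coe_ne_top _)

end Separable

/-! ### Comparison functions -/

namespace IsClassK

variable {γ : ℝ → ℝ} (hγ : IsClassK γ)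
include hγ

theorem monotoneOn : MonotoneOn γ (Ici 0) := hγ.2.2.monotoneOn

theorem pos {s : ℝ} (hs : 0 < s) : 0 < γ s :=
  hγ.2.1 ▸ hγ.2.2 self_mem_Ici hs.le hs

theorem nonneg {s : ℝ} (hs : 0 ≤ s) : 0 ≤ γ s :=
  hγ.2.1 ▸ hγ.monotoneOn self_mem_Ici hs hs

theorem exists_pos_le {b : ℝ} (hb : 0 < b) : ∃ s, 0 < s ∧ γ s ≤ b := by
  have hlim : Tendsto γ (𝓝[>] 0) (𝓝 0) := by
    simpa only [hγ.2.1] using ((hγ.1 0 self_mem_Ici).mono Ioi_subset_Ici_self).tendsto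
  obtain ⟨s, hsb, hs⟩ := ((hlim.eventually_lt_const hb).and self_mem_nhdsWithin).exists
  exact ⟨s, hs, hsb.le⟩

end IsClassK

theorem IsClassKInfty.exists_lt_map {γ : ℝ → ℝ} (hγ : IsClassKInfty γ) (R C : ℝ) :
    ∃ ρ, R < ρ ∧ C < γ ρ := by
  obtain ⟨_, ⟨e, he, rfl⟩, hCe⟩ := not_bddAbove_iff.1 hγ.2 C
  exact ⟨max e (R + 1), lt_max_of_lt_right (lt_add_one R),
    hCe.trans_le (hγ.1.monotoneOn he (mem_Ici.2 (le_max_of_le_left he)) (le_max_left _ _))⟩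

/-! ### Practical stability of sampled delay equations -/

/-- A Lyapunov–Krasovskii functional `V` for the delay equation with velocity field `φ ↦ A (φ, φ)`,
together with a bound `G (φ, ψ)` of its derivative along the velocity `A (φ, ψ)` obtained by
replacing the second argument by a sampled one. -/
structure IsKrasovskiiFunctional {Δ : ℝ} [Fact (0 < Δ)] {E : Type} [NormedAddCommGroup E]
    [NormedSpace ℝ E] (A : Hist Δ E × Hist Δ E → E) (V : Hist Δ E → ℝ)
    (G : Hist Δ E × Hist Δ E → ℝ) (α γ₁ γ₂ : ℝ → ℝ) : Prop where
  field : LipschitzOnBounded A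
  locallyLipschitz : LocallyLipschitz V
  rate : LipschitzOnBounded G
  driverDeriv_le : ∀ φ ψ, driverDeriv V φ (A (φ, ψ)) ≤ (G (φ, ψ) : EReal)
  rate_diag_le : ∀ φ, G (φ, φ) ≤ -α ‖φ (zeroPt Δ)‖
  decay_class : IsClassK α
  lower_class : IsClassKInfty γ₁
  upper_class : IsClassK γ₂
  lower_le : ∀ φ, γ₁ ‖φ (zeroPt Δ)‖ ≤ V φ
  le_upper : ∀ φ, V φ ≤ γ₂ ‖φ‖

/-- A curve with Lipschitz constant `L` that is bounded by `ρ` on `[-Δ, c)` and solves the sampled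
delay equation on `[0, c)` in the sense of right derivatives. -/
structure IsSampledTrajectory {Δ : ℝ} {E : Type} [NormedAddCommGroup E]
    [NormedSpace ℝ E] (A : Hist Δ E × Hist Δ E → E) (σ : ℝ → ℝ) (L : ℝ≥0) (ρ c : ℝ) (X : ℝ → E) :
    Prop where
  lipschitzWith : LipschitzWith L X
  norm_le : ∀ v ∈ Ico (-Δ) c, ‖X v‖ ≤ ρ
  hasDerivWithinAt : ∀ t ∈ Ico 0 c, HasDerivWithinAt X (sampledRhs A σ X t) (Ici t) t

section Stability

variable {Δ : ℝ} [Fact (0 < Δ)] {E : Type} [NormedAddCommGroup E] [NormedSpace ℝ E]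
  {A : Hist Δ E × Hist Δ E → E} {V : Hist Δ E → ℝ} {G : Hist Δ E × Hist Δ E → ℝ}
  {α γ₁ γ₂ : ℝ → ℝ} {σ : ℝ → ℝ} {δ ρ c : ℝ} {L : ℝ≥0} {X : ℝ → E}

omit [Fact (0 < Δ)] [NormedSpace ℝ E] in
theorem norm_hist_pair_sub_le (hX : LipschitzWith L X) (hσ : IsSampler δ σ) {t : ℝ} (ht : 0 ≤ t) :
    ‖(hist Δ X t, hist Δ X (σ t)) - (hist Δ X t, hist Δ X t)‖ ≤ L * δ := by
  have hδ : 0 ≤ δ := by linarith [hσ.sub_le t ht, hσ.le_self ht]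
  rw [Prod.mk_sub_mk, sub_self, norm_prod_le_iff, norm_zero]
  refine ⟨by positivity, ((lipschitzWith_hist hX).norm_sub_le _ _).trans ?_⟩
  rw [Real.norm_of_nonpos (sub_nonpos.2 (hσ.le_self ht))]
  exact mul_le_mul_of_nonneg_left (by linarith [hσ.sub_le t ht]) L.coe_nonneg

namespace IsKrasovskiiFunctional

variable (h : IsKrasovskiiFunctional A V G α γ₁ γ₂)
include h

theorem rate_hist_le {K : ℝ≥0} (hG : LipschitzOnWith K G (Metric.closedBall 0 ρ))
    (hσ : IsSampler δ σ) (hX : LipschitzWith L X) (hρ : 0 ≤ ρ) {t : ℝ} (ht : 0 ≤ t)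
    (hb : ∀ v ∈ Icc (-Δ) t, ‖X v‖ ≤ ρ) :
    G (hist Δ X t, hist Δ X (σ t)) ≤ -α ‖X t‖ + K * (L * δ) := by
  have hpair : (hist Δ X t, hist Δ X (σ t)) ∈ Metric.closedBall 0 ρ :=
    mem_closedBall_zero_iff.2 (norm_hist_pair_le hσ hX.continuous hρ ht hb)
  have hhist : ‖hist Δ X t‖ ≤ ρ := (norm_fst_le _).trans (mem_closedBall_zero_iff.1 hpair)
  have hdiag : (hist Δ X t, hist Δ X t) ∈ Metric.closedBall 0 ρ :=
    mem_closedBall_zero_iff.2 (norm_prod_le_iff.2 ⟨hhist, hhist⟩)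
  have herr := (Real.le_norm_self _).trans ((hG.norm_sub_le hpair hdiag).trans
    (mul_le_mul_of_nonneg_left (norm_hist_pair_sub_le hX hσ ht) K.coe_nonneg))
  have hrate := h.rate_diag_le (hist Δ X t)
  rw [hist_zeroPt hX.continuous] at hrate
  linarith

theorem lowerDiniLE {K : ℝ≥0} (hG : LipschitzOnWith K G (Metric.closedBall 0 ρ))
    (hσ : IsSampler δ σ) (hX : IsSampledTrajectory A σ L ρ c X) (hρ : 0 ≤ ρ) {t : ℝ}
    (ht : t ∈ Ico 0 c) :
    LowerDiniLE (fun s => V (hist Δ X s)) t (-α ‖X t‖ + K * (L * δ)) :=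
  (lowerDiniLE_of_driverDeriv_le h.locallyLipschitz hX.lipschitzWith.continuous
    (hX.hasDerivWithinAt t ht) (h.driverDeriv_le _ _)).mono
    (h.rate_hist_le hG hσ hX.lipschitzWith hρ ht.1 fun v hv =>
      hX.norm_le v ⟨hv.1, hv.2.trans_lt ht.2⟩)

-- A curve with Lipschitz constant `L` and norm greater than `s` at some time keeps norm at least
-- `s / 2` for the time `s / (2 L)`; a curve of norm at most `s` on a whole window has `V ≤ γ₂ s`.
theorem practicalDecay {K : ℝ≥0} (hG : LipschitzOnWith K G (Metric.closedBall 0 ρ))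
    (hσ : IsSampler δ σ) (hX : IsSampledTrajectory A σ L ρ c X) (hρ : 0 ≤ ρ) (hL : 0 < L)
    {s ε b : ℝ} (hs : 0 < s) (hsb : γ₂ s ≤ b / 2) (hε₀ : 0 ≤ ε) (hε : K * (L * δ) ≤ ε)
    (hdrop : ε * (Δ + s / (2 * L)) ≤ α (s / 2) * (s / (2 * L)) / 2)
    (hbound : ε * (Δ + s / (2 * L)) ≤ b / 4) :
    PracticalDecay (fun t => V (hist Δ X t)) {u | s < ‖X u‖} Δ (s / (2 * L)) (α (s / 2)) ε b c where
  continuousOn :=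
    (h.locallyLipschitz.continuous.comp (continuous_hist hX.lipschitzWith.continuous)).continuousOn
  lowerDiniLE t ht := (h.lowerDiniLE hG hσ hX hρ ht).mono
    (by linarith [h.decay_class.nonneg (norm_nonneg (X t))])
  lowerDiniLE_of_mem u hu t ht htc := by
    have hLpos : (0 : ℝ) < L := hL
    have hnear : ‖X u‖ - ‖X t‖ ≤ s / 2 := calc
      ‖X u‖ - ‖X t‖ ≤ ‖X u - X t‖ := norm_sub_norm_le _ _
      _ ≤ L * (t - u) := by
        simpa [Real.norm_of_nonneg (sub_nonneg.2 ht.1), norm_sub_rev (X u)] using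
          hX.lipschitzWith.norm_sub_le t u
      _ ≤ L * (s / (2 * L)) := mul_le_mul_of_nonneg_left (by linarith [ht.2]) hLpos.le
      _ = s / 2 := by field_simp
    have hlarge : s / 2 ≤ ‖X t‖ := by linarith [mem_ofPred.1 hu.2]
    have hα := h.decay_class.monotoneOn (half_pos hs).le (norm_nonneg (X t)) hlarge
    exact (h.lowerDiniLE hG hσ hX hρ ⟨hu.1.1.trans ht.1, htc⟩).mono (by linarith)
  le_of_disjoint t _ hD := by
    have hsmall : ‖hist Δ X t‖ ≤ s := norm_hist_le hX.lipschitzWith.continuous hs.le fun v hv =>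
      not_lt.1 (disjoint_left.1 hD hv)
    exact ((h.le_upper _).trans (h.upper_class.monotoneOn (norm_nonneg _) hs.le hsmall)).trans hsb
  window_pos := Fact.out
  duration_pos := by positivity
  rate_pos := h.decay_class.pos (half_pos hs)
  error_nonneg := hε₀
  error_le_drop := hdrop
  error_le_bound := hbound

theorem exists_decay (L : ℝ≥0) (hρ : 0 ≤ ρ) {w₀ b : ℝ} (hw₀ : 0 ≤ w₀) (hb : 0 < b) :
    ∃ δ T : ℝ, 0 < δ ∧ 0 < T ∧ ∀ σ, IsSampler δ σ → ∀ c X, IsSampledTrajectory A σ L ρ c X →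
      V (hist Δ X 0) ≤ w₀ → ∀ t ∈ Icc 0 c,
        V (hist Δ X t) ≤ w₀ + b ∧ (T ≤ t → V (hist Δ X t) ≤ b) := by
  have hΔ : 0 < Δ := Fact.out
  obtain ⟨K, hG⟩ := h.rate (Metric.closedBall 0 ρ) Metric.isBounded_closedBall
  obtain ⟨s, hs, hsb⟩ := h.upper_class.exists_pos_le (half_pos hb)
  have hα := h.decay_class.pos (half_pos hs)
  set l := s / (2 * (L + 1 : ℝ≥0))
  obtain ⟨ε, hε, hε_lt⟩ := exists_pos_mul_lt
    (lt_min (by positivity : 0 < α (s / 2) * l / 2) (by positivity : 0 < b / 4)) (Δ + l)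
  rw [mul_comm, lt_min_iff] at hε_lt
  obtain ⟨δ, hδ, hδε⟩ := exists_pos_mul_lt hε (K * (L + 1 : ℝ≥0))
  rw [mul_assoc] at hδε
  refine ⟨δ, (w₀ / (α (s / 2) * l / 2) + 1) * (Δ + l), hδ, by positivity,
    fun σ hσ c X hX hXw₀ t ht => ?_⟩
  have hX' : IsSampledTrajectory A σ (L + 1) ρ c X :=
    { hX with lipschitzWith := hX.lipschitzWith.weaken le_self_add }
  have hdecay := h.practicalDecay hG hσ hX' hρ (by positivity) hs hsb hε.le hδε.le hε_lt.1.le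
    hε_lt.2.le
  exact ⟨hdecay.le_add hXw₀ hw₀ ht, hdecay.le_of_large hXw₀ ht⟩

end IsKrasovskiiFunctional

theorem forall_lt_of_no_escape {f : ℝ → ℝ} (hf : Continuous f) (h₀ : ∀ u ≤ 0, f u < ρ)
    (h : ∀ c, 0 ≤ c → (∀ u < c, f u < ρ) → f c < ρ) (t : ℝ) : f t < ρ := by
  by_contra! hbad
  have hclosed : IsClosed {t | ρ ≤ f t} := isClosed_le continuous_const hf
  have hlower : ∀ u ∈ {t | ρ ≤ f t}, 0 ≤ u := fun u hu =>
    le_of_not_ge fun hu₀ => not_lt_of_ge hu (h₀ u hu₀)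
  have hmin := hclosed.csInf_mem ⟨t, hbad⟩ ⟨0, hlower⟩
  refine not_lt_of_ge hmin (h _ (hlower _ hmin) fun u hu => ?_)
  by_contra! hu'
  exact not_le_of_gt hu (csInf_le ⟨0, hlower⟩ hu')

omit [Fact (0 < Δ)] in
theorem isSampledTrajectory_of_eqOn [CompleteSpace E] {A' : Hist Δ E × Hist Δ E → E}
    (hA' : LipschitzOnBounded A') (hAA' : EqOn A' A (Metric.closedBall 0 ρ))
    (hσ : IsSampler δ σ) (hXs : SolvesSampledOn A' σ X (Ici 0)) (hX : LipschitzWith L X)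
    (hρ : 0 ≤ ρ) (hb : ∀ v ∈ Ico (-Δ) c, ‖X v‖ ≤ ρ) : IsSampledTrajectory A σ L ρ c X where
  lipschitzWith := hX
  norm_le := hb
  hasDerivWithinAt t ht := by
    have hmem : (hist Δ X t, hist Δ X (σ t)) ∈ Metric.closedBall 0 ρ :=
      mem_closedBall_zero_iff.2 (norm_hist_pair_le hσ hX.continuous hρ ht.1 fun v hv =>
        hb v ⟨hv.1, hv.2.trans_lt ht.2⟩)
    have hderiv := hXs.hasDerivWithinAt hA' hσ hX.continuous ht.1
    rwa [sampledRhs, hAA' hmem] at hderiv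

omit [NormedSpace ℝ E] in
theorem lipschitzWith_IccExtendCM {φ : Hist Δ E} (hφ : LipschitzWith L φ) :
    LipschitzWith L (ContinuousMap.IccExtendCM φ) := by
  have := hφ.comp (LipschitzWith.projIcc (factLe Δ).out)
  rwa [mul_one] at this

-- The velocity field is truncated outside a ball, so that solutions are global and uniformly
-- Lipschitz; the functional then keeps them in the ball, where the truncation is inactive.
theorem IsKrasovskiiFunctional.exists_practical_stability [CompleteSpace E]
    (h : IsKrasovskiiFunctional A V G α γ₁ γ₂) (L : ℝ≥0) {R r : ℝ} (hR : 0 ≤ R) (hr : 0 < r) :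
    ∃ δ T ρ : ℝ, 0 < δ ∧ 0 < T ∧ 0 < ρ ∧ ∀ σ, IsSampler δ σ → ∀ φ : Hist Δ E,
      LipschitzWith L φ → ‖φ‖ ≤ R → ∃ X : ℝ → E, Continuous X ∧
        (∀ θ : Icc (-Δ) (0 : ℝ), X θ = φ θ) ∧ SolvesSampledOn A σ X (Ici 0) ∧
        (∀ s, ‖X s‖ ≤ ρ) ∧ ∀ s, T ≤ s → ‖X s‖ ≤ r := by
  have hγ₁ := h.lower_class.1
  obtain ⟨ρ, hRρ, hρ_large⟩ := h.lower_class.exists_lt_map R (γ₂ R + γ₁ r)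
  have hρ : 0 < ρ := hR.trans_lt hRρ
  obtain ⟨A', K, M, hK, hM, hA'⟩ := h.field.exists_eqOn_closedBall hρ
  have hA'b : LipschitzOnBounded A' := .of_lipschitzWith hK
  obtain ⟨δ, T, hδ, hT, hdecay⟩ :=
    h.exists_decay (L + M) hρ.le (h.upper_class.nonneg hR) (hγ₁.pos hr)
  refine ⟨δ, T, ρ, hδ, hT, hρ, fun σ hσ φ hφ hφR => ?_⟩
  obtain ⟨X, hX, hXφ, hXs⟩ := exists_solvesSampledOn hK hM hσ (ContinuousMap.IccExtendCM φ)
  have hXL : LipschitzWith (L + M) X := hXs.lipschitzWith hA'b hM hσ hX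
    fun u hu v hv => by rw [hXφ hu, hXφ hv]; exact lipschitzWith_IccExtendCM hφ u v
  have hXR : ∀ u ≤ 0, ‖X u‖ ≤ R := fun u hu => by
    rw [hXφ hu]
    exact (norm_IccExtendCM_le φ u).trans hφR
  have hV₀ : V (hist Δ X 0) ≤ γ₂ R := (h.le_upper _).trans (h.upper_class.monotoneOn (norm_nonneg _)
    hR (norm_hist_le hX hR fun v hv => hXR v hv.2))
  have hVX : ∀ t, γ₁ ‖X t‖ ≤ V (hist Δ X t) := fun t => by
    simpa only [hist_zeroPt hX] using h.lower_le (hist Δ X t)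
  have hdecayX : ∀ c, 0 ≤ c → (∀ u < c, ‖X u‖ < ρ) →
      V (hist Δ X c) ≤ γ₂ R + γ₁ r ∧ (T ≤ c → V (hist Δ X c) ≤ γ₁ r) := fun c hc hXc =>
    hdecay σ hσ c X (isSampledTrajectory_of_eqOn hA'b hA' hσ hXs hXL hρ.le
      fun v hv => (hXc v hv.2).le) hV₀ c (right_mem_Icc.2 hc)
  have hXρ : ∀ t, ‖X t‖ < ρ := forall_lt_of_no_escape hX.norm
    (fun u hu => (hXR u hu).trans_lt hRρ) fun c hc hXc =>
      (hγ₁.2.2.lt_iff_lt (norm_nonneg _) hρ.le).1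
        (((hVX c).trans (hdecayX c hc hXc).1).trans_lt hρ_large)
  refine ⟨X, hX, fun θ => ?_, ?_, fun s => (hXρ s).le, fun s hs => ?_⟩
  · rw [hXφ θ.2.2, IccExtendCM_coe]
  · exact hXs.of_eqOn_closedBall hσ hX hρ.le subset_rfl (fun s _ v _ => (hXρ v).le) hA'
  · exact (hγ₁.2.2.le_iff_le (norm_nonneg _) hr.le).1
      ((hVX s).trans ((hdecayX s (hT.le.trans hs) fun u _ => hXρ u).2 hs))

end Stability

/-! ### The plant and the observer as one sampled system -/

section Blocks

variable {Δ : ℝ} {n m q : ℕ}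

theorem topBlock_stack (v w : Eu n) : topBlock (stack v w) = v := rfl

theorem botBlock_stack (v w : Eu n) : botBlock (stack v w) = w := rfl

theorem ext_blocks {v w : Eu2 n} (htop : topBlock v = topBlock w) (hbot : botBlock v = botBlock w) :
    v = w := by
  ext (i | i)
  exacts [congr($htop i), congr($hbot i)]

/-- `topBlock` as a continuous linear map, so that it commutes with derivatives and integrals. -/
noncomputable def topCLM (n : ℕ) : Eu2 n →L[ℝ] Eu n :=
  LinearMap.toContinuousLinearMap
    { toFun := topBlock, map_add' := fun _ _ => rfl, map_smul' := fun _ _ => rfl }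

/-- `botBlock` as a continuous linear map, so that it commutes with derivatives and integrals. -/
noncomputable def botCLM (n : ℕ) : Eu2 n →L[ℝ] Eu n :=
  LinearMap.toContinuousLinearMap
    { toFun := botBlock, map_add' := fun _ _ => rfl, map_smul' := fun _ _ => rfl }

theorem norm_sq_eq_blocks (v : Eu2 n) : ‖v‖ ^ 2 = ‖topBlock v‖ ^ 2 + ‖botBlock v‖ ^ 2 := by
  simp only [EuclideanSpace.norm_sq_eq, Fintype.sum_sum_type]
  rfl

theorem norm_topBlock_le (v : Eu2 n) : ‖topBlock v‖ ≤ ‖v‖ := by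
  refine le_of_sq_le_sq ?_ (norm_nonneg _)
  linarith [norm_sq_eq_blocks v, sq_nonneg ‖botBlock v‖]

theorem norm_botBlock_le (v : Eu2 n) : ‖botBlock v‖ ≤ ‖v‖ := by
  refine le_of_sq_le_sq ?_ (norm_nonneg _)
  linarith [norm_sq_eq_blocks v, sq_nonneg ‖topBlock v‖]

theorem norm_stack_le (v w : Eu n) : ‖stack v w‖ ≤ ‖v‖ + ‖w‖ := by
  refine le_of_sq_le_sq ?_ (by positivity)
  rw [norm_sq_eq_blocks, topBlock_stack, botBlock_stack]
  nlinarith [mul_nonneg (norm_nonneg v) (norm_nonneg w)]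

theorem dist_stack_le (v w v' w' : Eu n) :
    dist (stack v w) (stack v' w') ≤ dist v v' + dist w w' := by
  have h : stack v w - stack v' w' = stack (v - v') (w - w') := by
    ext (i | i) <;> rfl
  simpa only [dist_eq_norm, h] using norm_stack_le (v - v') (w - w')

theorem lipschitzWith_stack : LipschitzWith 2 fun p : Eu n × Eu n => stack p.1 p.2 := by
  refine LipschitzWith.of_dist_le_mul fun p p' => (dist_stack_le _ _ _ _).trans ?_
  rw [NNReal.coe_ofNat, two_mul]
  exact add_le_add (le_max_left _ _) (le_max_right _ _)

theorem lipschitzWith_fstHist : LipschitzWith 1 (fstHist : Hist Δ (Eu2 n) → Hist Δ (Eu n)) := by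
  refine LipschitzWith.mk_one fun φ ψ => (ContinuousMap.dist_le dist_nonneg).2 fun θ => ?_
  refine le_trans ?_ (ContinuousMap.dist_apply_le_dist (f := φ) (g := ψ) θ)
  rw [dist_eq_norm, dist_eq_norm]
  exact norm_topBlock_le (φ θ - ψ θ)

theorem lipschitzWith_sndHist : LipschitzWith 1 (sndHist : Hist Δ (Eu2 n) → Hist Δ (Eu n)) := by
  refine LipschitzWith.mk_one fun φ ψ => (ContinuousMap.dist_le dist_nonneg).2 fun θ => ?_
  refine le_trans ?_ (ContinuousMap.dist_apply_le_dist (f := φ) (g := ψ) θ)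
  rw [dist_eq_norm, dist_eq_norm]
  exact norm_botBlock_le (φ θ - ψ θ)

theorem norm_pairHist_le (φ ψ : Hist Δ (Eu n)) : ‖pairHist φ ψ‖ ≤ ‖φ‖ + ‖ψ‖ := by
  refine (ContinuousMap.norm_le _ (by positivity)).2 fun θ => ?_
  exact (norm_stack_le _ _).trans (add_le_add (φ.norm_coe_le_norm θ) (ψ.norm_coe_le_norm θ))

theorem lipschitzWith_pairHist {φ ψ : Hist Δ (Eu n)} {K L : ℝ≥0} (hφ : LipschitzWith K φ)
    (hψ : LipschitzWith L ψ) : LipschitzWith (K + L) (pairHist φ ψ) := by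
  refine LipschitzWith.of_dist_le_mul fun θ θ' => (dist_stack_le _ _ _ _).trans ?_
  rw [NNReal.coe_add, add_mul]
  exact add_le_add (hφ.dist_le_mul θ θ') (hψ.dist_le_mul θ θ')

theorem fstHist_hist {X : ℝ → Eu2 n} {s : ℝ} (hX : ContinuousOn X (Icc (s - Δ) s)) :
    fstHist (hist Δ X s) = hist Δ (fun u => topBlock (X u)) s :=
  (hist_comp (topCLM n : C(Eu2 n, Eu n)) hX).symm

theorem sndHist_hist {X : ℝ → Eu2 n} {s : ℝ} (hX : ContinuousOn X (Icc (s - Δ) s)) :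
    sndHist (hist Δ X s) = hist Δ (fun u => botBlock (X u)) s :=
  (hist_comp (botCLM n : C(Eu2 n, Eu n)) hX).symm

/-- The inputs of the system with right-hand side `openLoop`, namely the control and the velocity of
the observer, that the controller computes from the state `ψ`. -/
noncomputable def controllerInput (hout : Hist Δ (Eu n) → Eu q)
    (fhat : Hist Δ (Eu n) × Eu m × Eu q → Eu n) (k : Hist Δ (Eu n) × Eu q → Eu m)
    (ψ : Hist Δ (Eu2 n)) : Eu m × Eu n :=
  (k (sndHist ψ, hout (fstHist ψ)),
    fhat (sndHist ψ, k (sndHist ψ, hout (fstHist ψ)), hout (fstHist ψ)))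

/-- The velocity of the sampled-data loop with current state `p.1` and last sampled state `p.2`. -/
noncomputable def sampledField (f : Hist Δ (Eu n) × Eu m → Eu n) (hout : Hist Δ (Eu n) → Eu q)
    (fhat : Hist Δ (Eu n) × Eu m × Eu q → Eu n) (k : Hist Δ (Eu n) × Eu q → Eu m)
    (p : Hist Δ (Eu2 n) × Hist Δ (Eu2 n)) : Eu2 n :=
  openLoop f p.1 (controllerInput hout fhat k p.2)

variable {f : Hist Δ (Eu n) × Eu m → Eu n} {hout : Hist Δ (Eu n) → Eu q}
  {fhat : Hist Δ (Eu n) × Eu m × Eu q → Eu n} {k : Hist Δ (Eu n) × Eu q → Eu m}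

theorem sampledField_diag (φ : Hist Δ (Eu2 n)) :
    sampledField f hout fhat k (φ, φ) = closedLoop f hout fhat k φ := rfl

theorem lipschitzOnBounded_controllerInput (hh : LipschitzOnBounded hout)
    (hfhat : LipschitzOnBounded fhat) (hk : LipschitzOnBounded k) :
    LipschitzOnBounded (controllerInput hout fhat k) := by
  have hobs : LipschitzOnBounded (sndHist : Hist Δ (Eu2 n) → Hist Δ (Eu n)) :=
    .of_lipschitzWith lipschitzWith_sndHist
  have hy : LipschitzOnBounded fun ψ : Hist Δ (Eu2 n) => hout (fstHist ψ) :=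
    hh.comp (.of_lipschitzWith lipschitzWith_fstHist)
  have hu : LipschitzOnBounded fun ψ : Hist Δ (Eu2 n) => k (sndHist ψ, hout (fstHist ψ)) :=
    hk.comp (hobs.prodMk hy)
  exact hu.prodMk (hfhat.comp (hobs.prodMk (hu.prodMk hy)))

theorem lipschitzOnBounded_sampledField (hf : LipschitzOnBounded f) (hh : LipschitzOnBounded hout)
    (hfhat : LipschitzOnBounded fhat) (hk : LipschitzOnBounded k) :
    LipschitzOnBounded (sampledField f hout fhat k) := by
  have hinput : LipschitzOnBounded fun p : Hist Δ (Eu2 n) × Hist Δ (Eu2 n) =>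
      controllerInput hout fhat k p.2 :=
    (lipschitzOnBounded_controllerInput hh hfhat hk).comp .snd
  have hstate : LipschitzOnBounded fun p : Hist Δ (Eu2 n) × Hist Δ (Eu2 n) => fstHist p.1 :=
    (LipschitzOnBounded.of_lipschitzWith lipschitzWith_fstHist).comp .fst
  have hcontrol : LipschitzOnBounded fun p : Hist Δ (Eu2 n) × Hist Δ (Eu2 n) =>
      (controllerInput hout fhat k p.2).1 :=
    LipschitzOnBounded.comp (g := fun u : Eu m × Eu n => u.1) .fst hinput
  have hplant : LipschitzOnBounded fun p : Hist Δ (Eu2 n) × Hist Δ (Eu2 n) =>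
      f (fstHist p.1, (controllerInput hout fhat k p.2).1) := hf.comp (hstate.prodMk hcontrol)
  have hobs : LipschitzOnBounded fun p : Hist Δ (Eu2 n) × Hist Δ (Eu2 n) =>
      (controllerInput hout fhat k p.2).2 :=
    LipschitzOnBounded.comp (g := fun u : Eu m × Eu n => u.2) .snd hinput
  have hstack : LipschitzOnBounded fun p : Eu n × Eu n => stack p.1 p.2 :=
    .of_lipschitzWith lipschitzWith_stack
  have hfield := hstack.comp (hplant.prodMk hobs)
  exact hfield

end Blocks

section Lyapunov

variable {Δ : ℝ} [Fact (0 < Δ)] {n m q : ℕ}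

/-- The part of `LyapunovAssumption` that controls the sampled-data loop: a smoothly separable
functional `φ ↦ V₁ (φ 0) + V₂ φ` that decays along the closed loop, and whose nonsmooth part `V₂`
has a derivative `g` along the open loop that is Lipschitz on bounded sets. -/
structure IsSeparableLyapunov (f : Hist Δ (Eu n) × Eu m → Eu n) (hout : Hist Δ (Eu n) → Eu q)
    (fhat : Hist Δ (Eu n) × Eu m × Eu q → Eu n) (k : Hist Δ (Eu n) × Eu q → Eu m)
    (V₁ : Eu2 n → ℝ) (V₂ : Hist Δ (Eu2 n) → ℝ) (g : Hist Δ (Eu2 n) × (Eu m × Eu n) → ℝ)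
    (α γ₁ γ₂ : ℝ → ℝ) : Prop where
  contDiff : ContDiff ℝ 1 V₁
  fderiv_lipschitz : LocallyLipschitz (fderiv ℝ V₁)
  locallyLipschitz : LocallyLipschitz V₂
  rate : LipschitzOnBounded g
  driverDeriv_eq : ∀ φ u, driverDeriv V₂ φ (openLoop f φ u) = (g (φ, u) : EReal)
  decay_class : IsClassK α
  lower_class : IsClassKInfty γ₁
  upper_class : IsClassK γ₂
  lower_le : ∀ φ : Hist Δ (Eu2 n), γ₁ ‖φ (zeroPt Δ)‖ ≤ V₁ (φ (zeroPt Δ)) + V₂ φ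
  le_upper : ∀ φ : Hist Δ (Eu2 n), V₁ (φ (zeroPt Δ)) + V₂ φ ≤ γ₂ ‖φ‖
  decay : ∀ φ, driverDeriv (fun ψ => V₁ (ψ (zeroPt Δ)) + V₂ ψ) φ (closedLoop f hout fhat k φ) ≤
    ((-α ‖φ (zeroPt Δ)‖ : ℝ) : EReal)

variable {f : Hist Δ (Eu n) × Eu m → Eu n} {hout : Hist Δ (Eu n) → Eu q}
  {fhat : Hist Δ (Eu n) × Eu m × Eu q → Eu n} {k : Hist Δ (Eu n) × Eu q → Eu m}

theorem LyapunovAssumption.exists_isSeparableLyapunov (hV : LyapunovAssumption f hout fhat k) :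
    ∃ V₁ V₂ g α γ₁ γ₂, IsSeparableLyapunov f hout fhat k V₁ V₂ g α γ₁ γ₂ := by
  obtain ⟨V, V₁, V₂, _, _, γ₁, γ₂, _, α, _, _, _, hsep, hγ₁, hγ₂, -, -, -, -, -, hα, hγ, hdecay, -,
    g, hg, hgL⟩ := hV
  obtain rfl : V = fun φ => V₁ (φ (zeroPt Δ)) + V₂ φ := funext hsep.split
  exact ⟨V₁, V₂, g, α, γ₁, γ₂, hsep.V₁_contDiff, hsep.V₁_lipschitz, hsep.V₂_lipschitz, hgL, hg, hα,
    hγ₁, hγ₂.1, fun φ => (hγ φ).1, fun φ => (hγ φ).2, hdecay⟩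

theorem IsSeparableLyapunov.isKrasovskiiFunctional {V₁ : Eu2 n → ℝ} {V₂ : Hist Δ (Eu2 n) → ℝ}
    {g : Hist Δ (Eu2 n) × (Eu m × Eu n) → ℝ} {α γ₁ γ₂ : ℝ → ℝ}
    (h : IsSeparableLyapunov f hout fhat k V₁ V₂ g α γ₁ γ₂) (hf : LipschitzOnBounded f)
    (hh : LipschitzOnBounded hout) (hfhat : LipschitzOnBounded fhat) (hk : LipschitzOnBounded k) :
    IsKrasovskiiFunctional (sampledField f hout fhat k) (fun φ => V₁ (φ (zeroPt Δ)) + V₂ φ)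
      (fun p => fderiv ℝ V₁ (p.1 (zeroPt Δ)) (sampledField f hout fhat k p) +
        g (p.1, controllerInput hout fhat k p.2)) α γ₁ γ₂ := by
  have heval : LipschitzWith 1 fun φ : Hist Δ (Eu2 n) => φ (zeroPt Δ) :=
    LipschitzWith.mk_one fun φ ψ => ContinuousMap.dist_apply_le_dist _
  have hderiv : ∀ φ ψ, driverDeriv (fun ψ => V₁ (ψ (zeroPt Δ)) + V₂ ψ) φ
      (sampledField f hout fhat k (φ, ψ)) =
      ((fderiv ℝ V₁ (φ (zeroPt Δ)) (sampledField f hout fhat k (φ, ψ)) +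
        g (φ, controllerInput hout fhat k ψ) : ℝ) : EReal) := fun φ ψ =>
    driverDeriv_comp_zeroPt_add (h.contDiff.differentiable one_ne_zero _) (h.driverDeriv_eq φ _)
  have hfield := lipschitzOnBounded_sampledField hf hh hfhat hk
  have hgrad : LipschitzOnBounded fun p : Hist Δ (Eu2 n) × Hist Δ (Eu2 n) =>
      fderiv ℝ V₁ (p.1 (zeroPt Δ)) :=
    (LipschitzOnBounded.of_locallyLipschitz h.fderiv_lipschitz).comp
      ((LipschitzOnBounded.of_lipschitzWith heval).comp .fst)
  have hinput := (lipschitzOnBounded_controllerInput hh hfhat hk).comp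
    (LipschitzOnBounded.snd (X := Hist Δ (Eu2 n)))
  exact
    { field := hfield
      locallyLipschitz :=
        (h.contDiff.locallyLipschitz.comp heval.locallyLipschitz).add h.locallyLipschitz
      rate := (hgrad.clm_apply hfield).add (h.rate.comp (LipschitzOnBounded.fst.prodMk hinput))
      driverDeriv_le := fun φ ψ => (hderiv φ ψ).le
      rate_diag_le := fun φ => EReal.coe_le_coe_iff.1 <| by
        rw [← hderiv φ φ, sampledField_diag]
        exact h.decay φ
      decay_class := h.decay_class
      lower_class := h.lower_class
      upper_class := h.upper_class
      lower_le := h.lower_le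
      le_upper := h.le_upper }

end Lyapunov

/-! ### Absolutely continuous initial states -/

section AbsolutelyContinuous

theorem absolutelyContinuousOnInterval_comp_lipschitzWith {F G : Type} [PseudoMetricSpace F]
    [PseudoMetricSpace G] {g : F → G} {K : ℝ≥0} (hg : LipschitzWith K g) {x : ℝ → F} {a b : ℝ}
    (hx : AbsolutelyContinuousOnInterval x a b) :
    AbsolutelyContinuousOnInterval (fun s => g (x s)) a b := by
  rw [absolutelyContinuousOnInterval_iff] at hx ⊢
  intro ε hε
  obtain ⟨δ, hδ, h⟩ := hx (ε / (K + 1)) (by positivity)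
  refine ⟨δ, hδ, fun I hI hIδ => ?_⟩
  calc ∑ i ∈ Finset.range I.1, dist (g (x (I.2 i).1)) (g (x (I.2 i).2))
      ≤ ∑ i ∈ Finset.range I.1, (K + 1) * dist (x (I.2 i).1) (x (I.2 i).2) :=
        Finset.sum_le_sum fun i _ => (hg.dist_le_mul _ _).trans
          (mul_le_mul_of_nonneg_right (le_add_of_nonneg_right zero_le_one) dist_nonneg)
    _ = (K + 1) * ∑ i ∈ Finset.range I.1, dist (x (I.2 i).1) (x (I.2 i).2) :=
        (Finset.mul_sum _ _ _).symm
    _ < ε := (lt_div_iff₀' (by positivity)).1 (h I hI hIδ)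

theorem norm_sub_le_of_ae_norm_deriv_le {E : Type} [NormedAddCommGroup E] [NormedSpace ℝ E]
    [FiniteDimensional ℝ E] {x : ℝ → E} {a b L : ℝ} (hab : a ≤ b)
    (hx : AbsolutelyContinuousOnInterval x a b)
    (hL : ∀ᵐ s ∂(volume.restrict (Icc a b)), ‖deriv x s‖ ≤ L) : ‖x b - x a‖ ≤ L * (b - a) := by
  obtain ⟨g, hg, hgx⟩ := exists_dual_vector'' ℝ (x b - x a)
  have hderiv : ∀ᵐ s, s ∈ uIoc a b → ‖deriv (fun s => g (x s)) s‖ ≤ L := by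
    rw [ae_restrict_iff' measurableSet_Icc] at hL
    filter_upwards [hL, hx.boundedVariationOn.ae_differentiableAt_of_mem_uIcc] with s hsL hsd hs
    rw [uIoc_of_le hab] at hs
    rw [uIcc_of_le hab] at hsd
    have hgs : HasDerivAt (fun s => g (x s)) (g (deriv x s)) s :=
      g.hasFDerivAt.comp_hasDerivAt s (hsd (Ioc_subset_Icc_self hs)).hasDerivAt
    rw [hgs.deriv]
    exact (g.le_of_opNorm_le hg _).trans ((one_mul _).trans_le (hsL (Ioc_subset_Icc_self hs)))
  calc ‖x b - x a‖ = g (x b) - g (x a) := by rw [← map_sub]; exact hgx.symm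
    _ = ∫ s in a..b, deriv (fun s => g (x s)) s :=
      (absolutelyContinuousOnInterval_comp_lipschitzWith g.lipschitz hx).integral_deriv_eq_sub.symm
    _ ≤ L * |b - a| :=
      (le_abs_self _).trans (intervalIntegral.norm_integral_le_of_norm_le_const_ae hderiv)
    _ = L * (b - a) := by rw [abs_of_nonneg (sub_nonneg.2 hab)]

theorem W1InftyBound.lipschitzWith {Δ : ℝ} [Fact (0 < Δ)] {n : ℕ} {φ : Hist Δ (Eu n)} {L : ℝ}
    (h : W1InftyBound φ L) : LipschitzWith L.toNNReal φ := by
  have hdist : ∀ a b : Icc (-Δ) (0 : ℝ), a ≤ b → dist (φ a) (φ b) ≤ L.toNNReal * dist a b := by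
    intro a b (hab : (a : ℝ) ≤ b)
    have hsub : Icc (a : ℝ) b ⊆ Icc (-Δ) 0 := Icc_subset_Icc a.2.1 b.2.2
    have hac : AbsolutelyContinuousOnInterval (ContinuousMap.IccExtendCM φ) a b :=
      h.1.mono (by rwa [uIcc_of_le hab, uIcc_of_le (factLe Δ).out])
    have hle := norm_sub_le_of_ae_norm_deriv_le hab hac
      (ae_mono (Measure.restrict_mono hsub le_rfl) h.2)
    rw [IccExtendCM_coe, IccExtendCM_coe] at hle
    rw [dist_comm, dist_eq_norm, dist_comm, Subtype.dist_eq, Real.dist_eq,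
      abs_of_nonneg (sub_nonneg.2 hab)]
    exact hle.trans (mul_le_mul_of_nonneg_right (Real.le_coe_toNNReal L) (sub_nonneg.2 hab))
  refine LipschitzWith.of_dist_le_mul fun a b => ?_
  rcases le_total a b with hab | hab
  · exact hdist a b hab
  · simpa only [dist_comm] using hdist b a hab

end AbsolutelyContinuous

/-! ### Interpolation of the observer state -/

section Interp

variable {Δ : ℝ} [Fact (0 < Δ)] {n : ℕ} {a δ : ℝ} {t : ℕ → ℝ} {φ : Hist Δ (Eu n)} {z : ℕ → Eu n}

theorem interp_of_nonpos (t : ℕ → ℝ) (φ : Hist Δ (Eu n)) (z : ℕ → Eu n) {s : ℝ} (hs : s ≤ 0) :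
    interp t φ z s = ContinuousMap.IccExtendCM φ s := if_pos hs

theorem interp_of_pos (t : ℕ → ℝ) (φ : Hist Δ (Eu n)) (z : ℕ → Eu n) {s : ℝ} (hs : 0 < s) :
    interp t φ z s = z (lastIdx t s) +
      ((s - t (lastIdx t s)) / (t (lastIdx t s + 1) - t (lastIdx t s))) •
        (z (lastIdx t s + 1) - z (lastIdx t s)) := if_neg hs.not_ge

namespace IsPartition

variable (ht : IsPartition a δ t) (hz : z 0 = φ (zeroPt Δ))
include ht hz

theorem interp_eq {j : ℕ} {s : ℝ} (hs : s ∈ Icc (t j) (t (j + 1))) :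
    interp t φ z s = z j + ((s - t j) / (t (j + 1) - t j)) • (z (j + 1) - z j) := by
  have hpos : 0 < t (j + 1) - t j := sub_pos.2 (ht.strictMono j.lt_succ_self)
  rcases le_or_gt s 0 with hs₀ | hs₀
  · have hj : t j = 0 := le_antisymm (hs.1.trans hs₀) (ht.nonneg j)
    obtain rfl : s = 0 := le_antisymm hs₀ (hj ▸ hs.1)
    obtain rfl : j = 0 := ht.strictMono.injective (hj.trans ht.zero.symm)
    rw [interp_of_nonpos t φ z le_rfl, hj, sub_zero, zero_div, zero_smul, add_zero, hz]
    exact IccExtendCM_coe φ (zeroPt Δ)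
  · rw [interp_of_pos t φ z hs₀]
    rcases hs.2.lt_or_eq with hlt | rfl
    · rw [ht.lastIdx_eq ⟨hs.1, hlt⟩]
    · rw [ht.lastIdx_sample, sub_self, zero_div, zero_smul, div_self hpos.ne']
      module

theorem interp_sample (j : ℕ) : interp t φ z (t j) = z j := by
  rw [ht.interp_eq hz (left_mem_Icc.2 (ht.strictMono j.lt_succ_self).le), sub_self, zero_div,
    zero_smul, add_zero]

theorem continuous_interp : Continuous (interp t φ z) := by
  have hpiece : ∀ j, ContinuousOn (interp t φ z) (Icc (t j) (t (j + 1))) := fun j =>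
    ContinuousOn.congr (f := fun s => z j + ((s - t j) / (t (j + 1) - t j)) • (z (j + 1) - z j))
      (by fun_prop) fun s hs => ht.interp_eq hz hs
  have hall : ∀ j, ContinuousOn (interp t φ z) (Iic (t j)) := fun j => by
    induction j with
    | zero =>
      rw [ht.zero]
      exact (ContinuousMap.IccExtendCM φ).continuous.continuousOn.congr fun s hs =>
        interp_of_nonpos t φ z hs
    | succ j ih =>
      rw [← Iic_union_Icc_eq_Iic (ht.strictMono j.lt_succ_self).le]
      exact ih.union_of_isClosed (hpiece j) isClosed_Iic isClosed_Icc
  refine continuous_iff_continuousAt.2 fun s => ?_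
  obtain ⟨j, hj⟩ := (ht.tendsto.eventually_gt_atTop s).exists
  exact (hall j).continuousAt (Iic_mem_nhds hj)

theorem hasDerivAt_interp {j : ℕ} {s : ℝ} (hs : s ∈ Ioo (t j) (t (j + 1))) {v : Eu n}
    (hv : z (j + 1) = z j + (t (j + 1) - t j) • v) : HasDerivAt (interp t φ z) v s := by
  have hpos : 0 < t (j + 1) - t j := sub_pos.2 (ht.strictMono j.lt_succ_self)
  have hlin : HasDerivAt (fun s => z j + (s - t j) • v) v s := by
    simpa only [one_smul] using
      (((hasDerivAt_id' s).sub_const (t j)).smul_const v).const_add (z j)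
  refine hlin.congr_of_eventuallyEq ?_
  filter_upwards [Icc_mem_nhds hs.1 hs.2] with u hu
  rw [ht.interp_eq hz hu, hv, add_sub_cancel_left, smul_smul, div_mul_cancel₀ _ hpos.ne']

end IsPartition

end Interp

/-! ### Differential and integral form of the sampled-data loop -/

section IntegralForm

theorem integral_eq_sub_of_ae_hasDerivAt {E : Type} [NormedAddCommGroup E] [NormedSpace ℝ E]
    [CompleteSpace E] {x g : ℝ → E} {a b : ℝ} (hx : AbsolutelyContinuousOnInterval x a b)
    (hd : ∀ᵐ s, s ∈ uIcc a b → HasDerivAt x (g s) s) (hg : IntervalIntegrable g volume a b) :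
    ∫ s in a..b, g s = x b - x a := by
  refine SeparatingDual.eq_iff_forall_dual_eq (R := ℝ).2 fun T => ?_
  have hderiv : ∀ᵐ s, s ∈ uIoc a b → T (g s) = deriv (fun s => T (x s)) s := by
    filter_upwards [hd] with s hs hsab
    exact (T.hasFDerivAt.comp_hasDerivAt s (hs (uIoc_subset_uIcc hsab))).deriv.symm
  rw [← T.intervalIntegral_comp_comm hg, intervalIntegral.integral_congr_ae hderiv, map_sub]
  exact (absolutelyContinuousOnInterval_comp_lipschitzWith T.lipschitz hx).integral_deriv_eq_sub

variable {Δ : ℝ} {E : Type} [NormedAddCommGroup E] [NormedSpace ℝ E] {A : Hist Δ E × Hist Δ E → E}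
  {σ : ℝ → ℝ} {a δ : ℝ} {t : ℕ → ℝ} {X : ℝ → E}

omit [NormedSpace ℝ E] in
theorem IsPartition.sampledRhs_eq (ht : IsPartition a δ t) {j : ℕ} {s : ℝ}
    (hs : s ∈ Ico (t j) (t (j + 1))) :
    sampledRhs A (lastSample t) X s = A (hist Δ X s, hist Δ X (t j)) := by
  rw [sampledRhs, ht.lastSample_eq hs]

theorem SolvesSampledOn.integral_eq_sub (hXs : SolvesSampledOn A σ X (Ici 0))
    (hA : LipschitzOnBounded A) (hσ : IsSampler δ σ) (hX : Continuous X) {b c : ℝ} (hb : 0 ≤ b)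
    (hc : 0 ≤ c) : ∫ u in b..c, sampledRhs A σ X u = X c - X b := by
  have hint := intervalIntegrable_sampledRhs hA hσ hX
  rw [hXs b hb, hXs c hc, add_sub_add_left_eq_sub,
    intervalIntegral.integral_interval_sub_left (hint _ _) (hint _ _)]

theorem SolvesSampledOn.absolutelyContinuousOnInterval (hXs : SolvesSampledOn A σ X (Ici 0))
    (hA : LipschitzOnBounded A) (hσ : IsSampler δ σ) (hX : Continuous X) {c : ℝ} (hc : 0 ≤ c) :
    AbsolutelyContinuousOnInterval X 0 c := by
  obtain ⟨M, hM⟩ := exists_norm_sampledRhs_le hA hσ hX c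
  refine LipschitzOnWith.absolutelyContinuousOnInterval (K := M.toNNReal) ?_
  refine LipschitzOnWith.of_dist_le_mul fun u hu v hv => ?_
  rw [uIcc_of_le hc] at hu hv
  rw [dist_eq_norm, Real.dist_eq, ← hXs.integral_eq_sub hA hσ hX hv.1 hu.1]
  refine intervalIntegral.norm_integral_le_of_norm_le_const fun w hw => ?_
  have hw' := uIcc_subset_Icc hv hu (uIoc_subset_uIcc hw)
  exact (hM w hw'.2 (by linarith [hw'.1])).trans (Real.le_coe_toNNReal M)

theorem SolvesSampledOn.ae_hasDerivAt [CompleteSpace E] (hXs : SolvesSampledOn A σ X (Ici 0))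
    (hA : LipschitzOnBounded A) (hσ : IsSampler δ σ) (hX : Continuous X) (c : ℝ) :
    ∀ᵐ s, s ∈ Icc 0 c → HasDerivAt X (sampledRhs A σ X s) s := by
  filter_upwards [(intervalIntegrable_sampledRhs hA hσ hX 0 c).ae_hasDerivAt_integral,
    Measure.ae_ne volume 0] with s hs hs₀ hsc
  have hderiv := (hs (Icc_subset_uIcc hsc) 0 left_mem_uIcc).const_add (X 0)
  refine hderiv.congr_of_eventuallyEq ?_
  filter_upwards [Ioi_mem_nhds (hsc.1.lt_of_ne' hs₀)] with u hu
  exact hXs u (mem_Ici_of_Ioi hu)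

end IntegralForm

section Correspondence

theorem intervalIntegrable_clm_comp {F G : Type*} [NormedAddCommGroup F] [NormedSpace ℝ F]
    [NormedAddCommGroup G] [NormedSpace ℝ G] (T : F →L[ℝ] G) {g : ℝ → F} {b c : ℝ}
    (hg : IntervalIntegrable g volume b c) : IntervalIntegrable (fun u => T (g u)) volume b c :=
  ⟨T.integrable_comp hg.1, T.integrable_comp hg.2⟩

variable {Δ : ℝ} [Fact (0 < Δ)] {n m q : ℕ} {f : Hist Δ (Eu n) × Eu m → Eu n}
  {hout : Hist Δ (Eu n) → Eu q} {fhat : Hist Δ (Eu n) × Eu m × Eu q → Eu n}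
  {k : Hist Δ (Eu n) × Eu q → Eu m} {a δ : ℝ} {t : ℕ → ℝ} {x₀ xhat₀ : Hist Δ (Eu n)}

namespace IsSampledSolution

variable {b : EReal} {x : ℝ → Eu n} {z : ℕ → Eu n} {Y : ℝ → Eu2 n} {c : ℝ}

theorem exists_continuous_eqOn (h : IsSampledSolution f hout fhat k t x₀ xhat₀ b x z)
    (ht : IsPartition a δ t) (hc : 0 ≤ c) (hcb : (c : EReal) < b) :
    ∃ Y : ℝ → Eu2 n, Continuous Y ∧
      EqOn Y (fun s => stack (x s) (interp t xhat₀ z s)) (Icc (-Δ) c) := by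
  have hΔc : -Δ ≤ c := by linarith [Fact.out (p := 0 < Δ)]
  have hcont : ContinuousOn (fun s => stack (x s) (interp t xhat₀ z s)) (Icc (-Δ) c) :=
    lipschitzWith_stack.continuous.comp_continuousOn
      ((h.cont.mono fun s hs => ⟨hs.1, (EReal.coe_le_coe_iff.2 hs.2).trans_lt hcb⟩).prodMk
        (ht.continuous_interp h.obs_init).continuousOn)
  exact ⟨IccExtend hΔc ((Icc (-Δ) c).domRestrict fun s => stack (x s) (interp t xhat₀ z s)),
    hcont.domRestrict.Icc_extend', fun s hs => IccExtend_of_mem hΔc _ hs⟩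

theorem sampledRhs_eq_stack (ht : IsPartition a δ t) (hY : Continuous Y)
    (hYx : EqOn Y (fun s => stack (x s) (interp t xhat₀ z s)) (Icc (-Δ) c)) {j : ℕ} {s : ℝ}
    (hs : s ∈ Ico (t j) (t (j + 1))) (hsc : s ≤ c) :
    sampledRhs (sampledField f hout fhat k) (lastSample t) Y s =
      stack (f (hist Δ x s, k (obsHist t xhat₀ z j, hout (hist Δ x (t j)))))
        (fhat (obsHist t xhat₀ z j, k (obsHist t xhat₀ z j, hout (hist Δ x (t j))),
          hout (hist Δ x (t j)))) := by
  have hwindow : ∀ u ∈ Icc 0 c, ∀ v ∈ Icc (u - Δ) u, v ∈ Icc (-Δ) c := fun u hu v hv =>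
    ⟨by linarith [hu.1, hv.1], hv.2.trans hu.2⟩
  have hplant : ∀ u ∈ Icc 0 c, fstHist (hist Δ Y u) = hist Δ x u := fun u hu => by
    rw [fstHist_hist hY.continuousOn]
    refine hist_congr ((topCLM n).continuous.comp hY).continuousOn fun v hv => ?_
    rw [hYx (hwindow u hu v hv), topBlock_stack]
  have htj : t j ∈ Icc 0 c := ⟨ht.nonneg j, hs.1.trans hsc⟩
  have hobs : sndHist (hist Δ Y (t j)) = obsHist t xhat₀ z j := by
    rw [sndHist_hist hY.continuousOn, obsHist]
    refine hist_congr ((botCLM n).continuous.comp hY).continuousOn fun v hv => ?_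
    rw [hYx (hwindow (t j) htj v hv), botBlock_stack]
  simp only [ht.sampledRhs_eq hs, sampledField, openLoop, controllerInput, hobs, hplant (t j) htj,
    hplant s ⟨htj.1.trans hs.1, hsc⟩]

theorem integral_plant_eq_sub (h : IsSampledSolution f hout fhat k t x₀ xhat₀ b x z)
    (ht : IsPartition a δ t) (hA : LipschitzOnBounded (sampledField f hout fhat k))
    (hY : Continuous Y)
    (hYx : EqOn Y (fun s => stack (x s) (interp t xhat₀ z s)) (Icc (-Δ) c)) (hc : 0 ≤ c)
    (hcb : (c : EReal) < b) :
    ∫ u in (0 : ℝ)..c, topCLM n (sampledRhs (sampledField f hout fhat k) (lastSample t) Y u) =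
      x c - x 0 := by
  refine integral_eq_sub_of_ae_hasDerivAt (h.abs_cont c hc hcb) ?_
    (intervalIntegrable_clm_comp (topCLM n) (intervalIntegrable_sampledRhs hA ht.isSampler hY 0 c))
  filter_upwards [ae_all_iff.2 h.ode] with s hs hsc
  rw [uIcc_of_le hc] at hsc
  obtain ⟨j, hj⟩ := ht.exists_mem_Ico hsc.1
  rw [sampledRhs_eq_stack ht hY hYx hj hsc.2]
  exact hs j hj ((EReal.coe_le_coe_iff.2 hsc.2).trans_lt hcb)

theorem integral_observer_eq_sub (h : IsSampledSolution f hout fhat k t x₀ xhat₀ b x z)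
    (ht : IsPartition a δ t) (hA : LipschitzOnBounded (sampledField f hout fhat k))
    (hY : Continuous Y)
    (hYx : EqOn Y (fun s => stack (x s) (interp t xhat₀ z s)) (Icc (-Δ) c)) (hc : 0 ≤ c)
    (hcb : (c : EReal) < b) :
    ∫ u in (0 : ℝ)..c, botCLM n (sampledRhs (sampledField f hout fhat k) (lastSample t) Y u) =
      interp t xhat₀ z c - interp t xhat₀ z 0 := by
  refine integral_eq_of_hasDerivAt_off_countable_of_le _ _ hc (countable_range t)
    (ht.continuous_interp h.obs_init).continuousOn (fun s hs => ?_)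
    (intervalIntegrable_clm_comp (botCLM n) (intervalIntegrable_sampledRhs hA ht.isSampler hY 0 c))
  obtain ⟨j, hj⟩ := ht.exists_mem_Ico hs.1.1.le
  have hsj : s ∈ Ioo (t j) (t (j + 1)) := ⟨hj.1.lt_of_ne fun hjs => hs.2 ⟨j, hjs⟩, hj.2⟩
  rw [sampledRhs_eq_stack ht hY hYx hj hs.1.2.le]
  exact ht.hasDerivAt_interp h.obs_init hsj
    (h.euler j ((EReal.coe_le_coe_iff.2 (hj.1.trans hs.1.2.le)).trans_lt hcb))

theorem solvesSampledOn (h : IsSampledSolution f hout fhat k t x₀ xhat₀ b x z)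
    (ht : IsPartition a δ t) (hA : LipschitzOnBounded (sampledField f hout fhat k))
    (hY : Continuous Y)
    (hYx : EqOn Y (fun s => stack (x s) (interp t xhat₀ z s)) (Icc (-Δ) c))
    (hcb : (c : EReal) < b) :
    SolvesSampledOn (sampledField f hout fhat k) (lastSample t) Y (Icc 0 c) := by
  intro s hs
  have hΔ : 0 < Δ := Fact.out
  have hYs := hYx.mono (Icc_subset_Icc_right hs.2)
  have hsb : (s : EReal) < b := (EReal.coe_le_coe_iff.2 hs.2).trans_lt hcb
  have hint := intervalIntegrable_sampledRhs hA ht.isSampler hY 0 s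
  rw [← sub_eq_iff_eq_add', hYs ⟨by linarith [hs.1], le_rfl⟩, hYs ⟨by linarith, hs.1⟩]
  refine ext_blocks ?_ ?_
  · exact ((h.integral_plant_eq_sub ht hA hY hYs hs.1 hsb).symm.trans
      ((topCLM n).intervalIntegral_comp_comm hint))
  · exact ((h.integral_observer_eq_sub ht hA hY hYs hs.1 hsb).symm.trans
      ((botCLM n).intervalIntegral_comp_comm hint))

theorem eqOn_stack (h : IsSampledSolution f hout fhat k t x₀ xhat₀ b x z)
    (ht : IsPartition a δ t) (hA : LipschitzOnBounded (sampledField f hout fhat k)) {X : ℝ → Eu2 n}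
    (hX : Continuous X) (hX₀ : ∀ θ : Icc (-Δ) (0 : ℝ), X θ = pairHist x₀ xhat₀ θ)
    (hXs : SolvesSampledOn (sampledField f hout fhat k) (lastSample t) X (Ici 0)) (hc : 0 ≤ c)
    (hcb : (c : EReal) < b) :
    EqOn X (fun s => stack (x s) (interp t xhat₀ z s)) (Icc (-Δ) c) := by
  obtain ⟨Y, hY, hYx⟩ := h.exists_continuous_eqOn ht hc hcb
  have h₀ : EqOn X Y (Icc (-Δ) 0) := fun s hs => by
    rw [hYx ⟨hs.1, hs.2.trans hc⟩, hX₀ ⟨s, hs⟩]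
    beta_reduce
    rw [interp_of_nonpos t xhat₀ z hs.2, h.init ⟨s, hs⟩,
      IccExtendCM_coe xhat₀ ⟨s, hs⟩]
    rfl
  have h₁ : EqOn X Y (Icc 0 c) :=
    SolvesSampledOn.eqOn hA ht.isSampler hX hY h₀ (hXs.mono Icc_subset_Ici_self)
      (h.solvesSampledOn ht hA hY hYx hcb)
  intro s hs
  rcases le_total s 0 with hs₀ | hs₀
  · exact (h₀ ⟨hs.1, hs₀⟩).trans (hYx hs)
  · exact (h₁ ⟨hs₀, hs.2⟩).trans (hYx hs)

theorem eq_blocks (h : IsSampledSolution f hout fhat k t x₀ xhat₀ b x z)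
    (ht : IsPartition a δ t) (hA : LipschitzOnBounded (sampledField f hout fhat k)) {X : ℝ → Eu2 n}
    (hX : Continuous X) (hX₀ : ∀ θ : Icc (-Δ) (0 : ℝ), X θ = pairHist x₀ xhat₀ θ)
    (hXs : SolvesSampledOn (sampledField f hout fhat k) (lastSample t) X (Ici 0)) (hb : 0 < b) :
    (∀ s : ℝ, -Δ ≤ s → (s : EReal) < b → x s = topBlock (X s)) ∧
      ∀ j : ℕ, (t j : EReal) < b → z j = botBlock (X (t j)) := by
  have hΔ : 0 < Δ := Fact.out
  have hstack {c : ℝ} (hc : 0 ≤ c) (hcb : (c : EReal) < b) :=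
    h.eqOn_stack ht hA hX hX₀ hXs hc hcb
  refine ⟨fun s hs hsb => ?_, fun j hj => ?_⟩
  · have hmax : ((max s 0 : ℝ) : EReal) < b := by
      rcases max_choice s 0 with h | h <;> rw [h] <;> assumption
    rw [hstack (le_max_right s 0) hmax ⟨hs, le_max_left s 0⟩, topBlock_stack]
  · rw [hstack (ht.nonneg j) hj ⟨by linarith [ht.nonneg j], le_rfl⟩, botBlock_stack,
      ht.interp_sample h.obs_init]

end IsSampledSolution

namespace SolvesSampledOn

variable {X : ℝ → Eu2 n}
  (hXs : SolvesSampledOn (sampledField f hout fhat k) (lastSample t) X (Ici 0))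
  (hA : LipschitzOnBounded (sampledField f hout fhat k)) (ht : IsPartition a δ t)
  (hX : Continuous X)
include hXs hA ht hX

omit [Fact (0 < Δ)] in
theorem botBlock_eq {j : ℕ} {s : ℝ} (hs : s ∈ Icc (t j) (t (j + 1))) :
    botBlock (X s) = botBlock (X (t j)) +
      (s - t j) • (controllerInput hout fhat k (hist Δ X (t j))).2 := by
  have hint := intervalIntegrable_sampledRhs hA ht.isSampler hX (t j) s
  have hconst : ∫ u in (t j)..s,
        botCLM n (sampledRhs (sampledField f hout fhat k) (lastSample t) X u) =
      (s - t j) • (controllerInput hout fhat k (hist Δ X (t j))).2 := by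
    rw [← intervalIntegral.integral_const]
    refine intervalIntegral.integral_congr_uIoo fun u hu => ?_
    rw [uIoo_of_le hs.1] at hu
    beta_reduce
    rw [ht.sampledRhs_eq ⟨hu.1.le, hu.2.trans_le hs.2⟩]
    rfl
  rw [← sub_eq_iff_eq_add', ← hconst, (botCLM n).intervalIntegral_comp_comm hint,
    hXs.integral_eq_sub hA ht.isSampler hX (ht.nonneg j) ((ht.nonneg j).trans hs.1)]
  rfl

variable (hX₀ : ∀ θ : Icc (-Δ) (0 : ℝ), X θ = pairHist x₀ xhat₀ θ)
include hX₀

theorem interp_eqOn :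
    EqOn (interp t xhat₀ fun j => botBlock (X (t j))) (fun s => botBlock (X s)) (Ici (-Δ)) := by
  intro s hs
  have hz : botBlock (X (t 0)) = xhat₀ (zeroPt Δ) := by
    rw [ht.zero]
    exact congrArg botBlock (hX₀ (zeroPt Δ))
  rcases le_total s 0 with hs₀ | hs₀
  · have h := hX₀ ⟨s, hs, hs₀⟩
    rw [interp_of_nonpos t xhat₀ _ hs₀, IccExtendCM_coe xhat₀ ⟨s, hs, hs₀⟩]
    exact (congrArg botBlock h).symm
  · obtain ⟨j, hj⟩ := ht.exists_mem_Ico hs₀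
    have hle : t j ≤ t (j + 1) := hj.1.trans hj.2.le
    have hpos : 0 < t (j + 1) - t j := sub_pos.2 (hj.1.trans_lt hj.2)
    beta_reduce
    rw [ht.interp_eq hz (Ico_subset_Icc_self hj), hXs.botBlock_eq hA ht hX (Ico_subset_Icc_self hj),
      hXs.botBlock_eq hA ht hX (right_mem_Icc.2 hle), add_sub_cancel_left, smul_smul,
      div_mul_cancel₀ _ hpos.ne']

theorem obsHist_eq (j : ℕ) :
    obsHist t xhat₀ (fun j => botBlock (X (t j))) j = hist Δ (fun s => botBlock (X s)) (t j) := by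
  have hbot : Continuous fun s => botBlock (X s) := (botCLM n).continuous.comp hX
  refine (hist_congr hbot.continuousOn fun v hv => ?_).symm
  exact (hXs.interp_eqOn hA ht hX hX₀ (mem_Ici.2 (by linarith [hv.1, ht.nonneg j]))).symm

theorem isSampledSolution :
    IsSampledSolution f hout fhat k t x₀ xhat₀ ⊤ (fun s => topBlock (X s))
      fun j => botBlock (X (t j)) := by
  have hinput : ∀ j, controllerInput hout fhat k (hist Δ X (t j)) =
      (k (obsHist t xhat₀ (fun j => botBlock (X (t j))) j,
          hout (hist Δ (fun s => topBlock (X s)) (t j))),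
        fhat (obsHist t xhat₀ (fun j => botBlock (X (t j))) j,
          k (obsHist t xhat₀ (fun j => botBlock (X (t j))) j,
            hout (hist Δ (fun s => topBlock (X s)) (t j))),
          hout (hist Δ (fun s => topBlock (X s)) (t j)))) := fun j => by
    rw [hXs.obsHist_eq hA ht hX hX₀, controllerInput, sndHist_hist hX.continuousOn,
      fstHist_hist hX.continuousOn]
  refine ⟨fun θ => congrArg topBlock (hX₀ θ), ?_, ((topCLM n).continuous.comp hX).continuousOn,
    fun c hc _ => absolutelyContinuousOnInterval_comp_lipschitzWith (topCLM n).lipschitz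
      (hXs.absolutelyContinuousOnInterval hA ht.isSampler hX hc), fun j => ?_, fun j _ => ?_⟩
  · rw [ht.zero]
    exact congrArg botBlock (hX₀ (zeroPt Δ))
  · filter_upwards [hXs.ae_hasDerivAt hA ht.isSampler hX (t (j + 1))] with s hs hj _
    have hderiv := hs ⟨(ht.nonneg j).trans hj.1, hj.2.le⟩
    rw [ht.sampledRhs_eq hj, sampledField, openLoop, hinput, fstHist_hist hX.continuousOn] at hderiv
    exact (topCLM n).hasFDerivAt.comp_hasDerivAt s hderiv
  · have hle : t j ≤ t (j + 1) := (ht.strictMono j.lt_succ_self).le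
    rw [hXs.botBlock_eq hA ht hX (right_mem_Icc.2 hle), hinput]

theorem norm_pairHist_le {s ρ : ℝ} {j : ℕ} (hρ : 0 ≤ ρ) (hs : ∀ u ∈ Icc (s - Δ) s, ‖X u‖ ≤ ρ)
    (hj : ∀ u ∈ Icc (t j - Δ) (t j), ‖X u‖ ≤ ρ) :
    ‖pairHist (hist Δ (fun s => topBlock (X s)) s)
      (obsHist t xhat₀ (fun j => botBlock (X (t j))) j)‖ ≤ ρ + ρ := by
  rw [hXs.obsHist_eq hA ht hX hX₀]
  refine (EulerEmulation.norm_pairHist_le _ _).trans (add_le_add ?_ ?_)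
  · exact norm_hist_le ((topCLM n).continuous.comp hX) hρ fun u hu =>
      (norm_topBlock_le _).trans (hs u hu)
  · exact norm_hist_le ((botCLM n).continuous.comp hX) hρ fun u hu =>
      (norm_botBlock_le _).trans (hj u hu)

end SolvesSampledOn

end Correspondence

end EulerEmulation

open EulerEmulation in
theorem theorem1_general (Δ : ℝ) [Fact (0 < Δ)] {n m q : ℕ} {f : Hist Δ (Eu n) × Eu m → Eu n}
    {hout : Hist Δ (Eu n) → Eu q} {fhat : Hist Δ (Eu n) × Eu m × Eu q → Eu n}
    {k : Hist Δ (Eu n) × Eu q → Eu m} (hf : LipschitzOnBounded f) (hh : LipschitzOnBounded hout)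
    (hfhat : LipschitzOnBounded fhat) (hk : LipschitzOnBounded k) {V₁ : Eu2 n → ℝ}
    {V₂ : Hist Δ (Eu2 n) → ℝ} {g : Hist Δ (Eu2 n) × (Eu m × Eu n) → ℝ} {α γ₁ γ₂ : ℝ → ℝ}
    (hV : IsSeparableLyapunov f hout fhat k V₁ V₂ g α γ₁ γ₂) (L R : ℝ) {r : ℝ} (hr : 0 < r) :
    ∃ δ T E : ℝ, 0 < δ ∧ 0 < T ∧ 0 < E ∧
      ∀ (a : ℝ) (t : ℕ → ℝ), IsPartition a δ t → ∀ x₀ xhat₀ : Hist Δ (Eu n),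
        W1InftyBound x₀ L → W1InftyBound xhat₀ L → ‖pairHist x₀ xhat₀‖ ≤ R →
        ∃ (x : ℝ → Eu n) (z : ℕ → Eu n),
          IsSampledSolution f hout fhat k t x₀ xhat₀ ⊤ x z ∧
          (∀ (b : EReal) (x' : ℝ → Eu n) (z' : ℕ → Eu n), 0 < b →
            IsSampledSolution f hout fhat k t x₀ xhat₀ b x' z' →
            (∀ s : ℝ, -Δ ≤ s → (s : EReal) < b → x' s = x s) ∧
            (∀ j : ℕ, (t j : EReal) < b → z' j = z j)) ∧
          (∀ s : ℝ, 0 ≤ s → ∀ j : ℕ, ‖pairHist (hist Δ x s) (obsHist t xhat₀ z j)‖ ≤ E) ∧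
          (∀ s : ℝ, T ≤ s → ∀ j : ℕ, T ≤ t j →
            ‖pairHist (hist Δ x s) (obsHist t xhat₀ z j)‖ ≤ r) := by
  have hA := lipschitzOnBounded_sampledField hf hh hfhat hk
  obtain ⟨δ, T, ρ, hδ, hT, hρ, hstable⟩ :=
    (hV.isKrasovskiiFunctional hf hh hfhat hk).exists_practical_stability
      (L.toNNReal + L.toNNReal) (abs_nonneg R) (half_pos hr)
  refine ⟨δ, T + Δ, ρ + ρ, hδ, add_pos hT Fact.out, add_pos hρ hρ,
    fun a t ht x₀ xhat₀ hx₀ hxhat₀ hR => ?_⟩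
  obtain ⟨X, hX, hX₀, hXs, hXρ, hXr⟩ := hstable (lastSample t) ht.isSampler (pairHist x₀ xhat₀)
    (lipschitzWith_pairHist hx₀.lipschitzWith hxhat₀.lipschitzWith) (hR.trans (le_abs_self R))
  refine ⟨fun s => topBlock (X s), fun j => botBlock (X (t j)),
    hXs.isSampledSolution hA ht hX hX₀,
    fun b x' z' hb h => h.eq_blocks ht hA hX hX₀ hXs hb,
    fun s _ j => hXs.norm_pairHist_le hA ht hX hX₀ hρ.le (fun u _ => hXρ u) fun u _ => hXρ u,
    fun s hs j hj => ?_⟩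
  rw [← add_halves r]
  exact hXs.norm_pairHist_le hA ht hX hX₀ (half_pos hr).le
    (fun u hu => hXr u (by linarith [hu.1])) fun u hu => hXr u (by linarith [hu.1])

theorem theorem1 (Δ : ℝ) [Fact (0 < Δ)] (n m q : ℕ) (hn : 0 < n) (hm : 0 < m) (hq : 0 < q)
    (f : EulerEmulation.Hist Δ (EulerEmulation.Eu n) × EulerEmulation.Eu m → EulerEmulation.Eu n)
    (hout : EulerEmulation.Hist Δ (EulerEmulation.Eu n) → EulerEmulation.Eu q)
    (fhat : EulerEmulation.Hist Δ (EulerEmulation.Eu n) ×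
      EulerEmulation.Eu m × EulerEmulation.Eu q → EulerEmulation.Eu n)
    (k : EulerEmulation.Hist Δ (EulerEmulation.Eu n) × EulerEmulation.Eu q → EulerEmulation.Eu m)
    (hf : EulerEmulation.LipschitzOnBounded f) (hf0 : f 0 = 0)
    (hh : EulerEmulation.LipschitzOnBounded hout) (hh0 : hout 0 = 0)
    (hfhat : EulerEmulation.LipschitzOnBounded fhat) (hfhat0 : fhat 0 = 0)
    (hk : EulerEmulation.LipschitzOnBounded k) (hk0 : k 0 = 0)
    (hV : EulerEmulation.LyapunovAssumption f hout fhat k)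
    (qtilde : ℝ) (hqtilde : 0 < qtilde)
    (a : ℝ) (ha0 : 0 < a) (ha1 : a ≤ 1)
    (R r : ℝ) (hr : 0 < r) (hrR : r < R) :
    ∃ δ T E : ℝ, 0 < δ ∧ 0 < T ∧ 0 < E ∧
      ∀ t : ℕ → ℝ, EulerEmulation.IsPartition a δ t →
      ∀ x₀ xhat₀ : EulerEmulation.Hist Δ (EulerEmulation.Eu n),
        EulerEmulation.W1InftyBound x₀ (qtilde / √2) →
        EulerEmulation.W1InftyBound xhat₀ (qtilde / √2) →
        ‖EulerEmulation.pairHist x₀ xhat₀‖ ≤ R →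
        ∃ (x : ℝ → EulerEmulation.Eu n) (z : ℕ → EulerEmulation.Eu n),
          -- the solution exists on the whole of `[0, ∞)`
          EulerEmulation.IsSampledSolution f hout fhat k t x₀ xhat₀ ⊤ x z ∧
          -- it is the solution: every solution, on any interval `[0, b)`, is a restriction of it
          (∀ (b : EReal) (x' : ℝ → EulerEmulation.Eu n) (z' : ℕ → EulerEmulation.Eu n), 0 < b →
            EulerEmulation.IsSampledSolution f hout fhat k t x₀ xhat₀ b x' z' →
            (∀ s : ℝ, -Δ ≤ s → (s : EReal) < b → x' s = x s) ∧
            (∀ j : ℕ, (t j : EReal) < b → z' j = z j)) ∧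
          -- it stays in the ball of radius `E`
          (∀ s : ℝ, 0 ≤ s → ∀ j : ℕ,
            ‖EulerEmulation.pairHist (EulerEmulation.hist Δ x s)
              (EulerEmulation.obsHist t xhat₀ z j)‖ ≤ E) ∧
          -- it is in the ball of radius `r` after time `T`
          (∀ s : ℝ, T ≤ s → ∀ j : ℕ, T ≤ t j →
            ‖EulerEmulation.pairHist (EulerEmulation.hist Δ x s)
              (EulerEmulation.obsHist t xhat₀ z j)‖ ≤ r) := by
  obtain ⟨V₁, V₂, g, α, γ₁, γ₂, hsep⟩ := hV.exists_isSeparableLyapunov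
  obtain ⟨δ, T, E, hδ, hT, hE, hsol⟩ :=
    theorem1_general Δ hf hh hfhat hk hsep (qtilde / √2) R hr
  exact ⟨δ, T, E, hδ, hT, hE, hsol a⟩
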